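/- A reachability MDP consists of a finite set $S$ of nodes (states), a finite set $A_s$ of available actions for each $s\in S$ (a sink is a node with $A_s=\emptyset$), a probability distribution $p(\cdot\mid s,a)$ on $S$ for each $s \in S$ and $a\in A_s$, and a designated target sink $s^*$; there are no rewards. A policy $\pi$ selects an action $\pi(s)\in A_s$ at each non-sink node $s$. Its value $\mathrm{Val}^\pi(s)$ is the probability that the Markov chain which starts at $s$, follows $\pi$ and stays at sinks reaches $s^*$. The appeal of $a\in A_s$ under $\pi$ is $\mathrm{Appeal}^\pi(s,a)=\sum_{s'\in S}p(s'\mid s,a)\,\mathrm{Val}^\pi(s')$, and $s$ is switchable if $\mathrm{Appeal}^\pi(s,a)>\mathrm{Val}^\pi(s)$ for some $a\in A_s$. One iteration of Greedy (Howard's) policy iteration simultaneously switches every switchable node $s$ to an action in $\arg\max_{a\in A_s}\mathrm{Appeal}^\pi(s,a)$ (ties broken arbitrarily) and leaves all other nodes unchanged. A policy is optimal if it maximizes the value of every node among all policies. Theorem. Greedy policy iteration under the reachability criterion can take $2^{\Omega(N)}$ iterations to arrive at an optimal policy on an MDP with $N$ nodes. Precisely: there are a constant $c>0$ and an $N_0$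 such that for every $N\ge N_0$ there exist a reachability MDP with exactly $N$ nodes and at most $N$ actions at each node, and a starting policy $\pi_0$, such that every run of Greedy policy iteration started at $\pi_0$ (whatever the tie-breaking) arrives at an optimal policy, and does so for the first time after at least $2^{cN}$ iterations. -/

import Mathlib

/-- A finite Markov decision process without rewards, with state set `S`, all actions taken from
`A`, and a designated target sink.  `act s` is the finite set of actions available at `s`;
a *sink* is a state with no actions.  `p s a s'` is the probability of ending up at `s'` when
action `a ∈ act s` is taken at `s` (its value for `a ∉ act s` is irrelevant). -/
structure ReachabilityMDP (S A : Type) [Fintype S] where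
  act : S → Finset A
  p : S → A → S → ℝ
  p_nonneg : ∀ s, ∀ a ∈ act s, ∀ s', 0 ≤ p s a s'
  p_sum : ∀ s, ∀ a ∈ act s, ∑ s', p s a s' = 1
  target : S
  target_sink : act target = ∅

namespace ReachabilityMDP

variable {S A : Type} [Fintype S] [DecidableEq S] (M : ReachabilityMDP S A)

/-- A (positional) policy selects an available action at every state that is not a sink.
(The value of `π` at a sink plays no role anywhere.) -/
def IsPolicy (π : S → A) : Prop :=
  ∀ s, (M.act s).Nonempty → π s ∈ M.act s

/-- The transition matrix of the Markov chain induced by a policy: at a state that is not a sink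
the chain follows the selected action; once in a sink it stays there. -/
noncomputable def chain (π : S → A) : Matrix S S ℝ := fun s s' =>
  if (M.act s).Nonempty then M.p s (π s) s' else if s' = s then 1 else 0

/-- The value of `s` under `π`: the probability that the induced chain started at `s` reaches the
target.  As the chain never leaves the target, `(chain π ^ k) s target` is the probability that the
target is reached within `k` steps; it is nondecreasing in `k`, and its supremum is the probability
that the target is ever reached. -/
noncomputable def val (π : S → A) (s : S) : ℝ :=
  ⨆ k : ℕ, (M.chain π ^ k) s M.target

/-- The appeal of the action `a` at `s` under the current policy `π`. -/
noncomputable def appeal (π : S → A) (s : S) (a : A) : ℝ :=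
  ∑ s', M.p s a s' * M.val π s'

/-- A state is switchable if some available action has appeal larger than the state's value. -/
def Switchable (π : S → A) (s : S) : Prop :=
  ∃ a ∈ M.act s, M.val π s < M.appeal π s a

/-- One iteration of Greedy (Howard's) policy iteration: every switchable state switches to an
available action of greatest appeal (ties broken in any way); every other state keeps its
action. -/
def GreedyStep (π π' : S → A) : Prop :=
  ∀ s, (M.Switchable π s →
      π' s ∈ M.act s ∧ ∀ a ∈ M.act s, M.appeal π s a ≤ M.appeal π s (π' s)) ∧
    (¬ M.Switchable π s → π' s = π s)

/-- An optimal policy maximizes the value of every state among all policies. -/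
def IsOptimal (π : S → A) : Prop :=
  M.IsPolicy π ∧ ∀ π', M.IsPolicy π' → ∀ s, M.val π' s ≤ M.val π s

end ReachabilityMDP

/-! ### Values as least superharmonic functions, and a criterion for optimality -/

namespace ReachabilityMDP

variable {S A : Type} [Fintype S] [DecidableEq S] (M : ReachabilityMDP S A)

/-! Rewards are simulated by loss of probability. If an edge of cost `c` leads to its endpoint with
probability `2^(-c)` and otherwise to a dead sink, a node at path length `D` from the target has
value `2^(-D)`. Policy iteration then shortens paths. An edge may also be followed at a small rate,
the state otherwise staying put: this leaves the value of a policy using it unchanged but scales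
down the gain in appeal. A greedy step therefore takes a slow edge only where no fast edge improves
(`greedy_eq_fast`, `greedy_eq_slow`).

On such a graph Greedy is made to run an `n`-bit counter `B`. Bit `k` is closed if it jumps on to
the next set bit, and open if it returns to the hub or a lane. Jump costs telescope along the powers
`2^m`, and passing through the closed bit `k` saves `2^k`, so the leading length from the hub is
`2^n - 1 - B` and larger counters are better. Costs are ordered lexicographically: a large `scale`
times the leading part, plus a lower-order part that settles ties strictly.

Closing a bit is slow. An open bit is distracted by the lanes: in phase `t` lane `t` offers a
lower-order gain of one, and bit `k` has edges only to lanes `0, ..., 2 * k`. So the lowest unset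
bit `i` runs out first and closes in phase `2 * i + 1`. In the next step the hub and the entry of
`i` notice. For one phase the hub is then better than the lanes, whose values are stale; all lanes,
all open bits and all bits below `i` turn to the hub, and the counter `B + 1` starts at phase `0`.

`isDist_pol` gives the path lengths in each phase, `step_within` and `step_increment` determine the
greedy step whatever the tie-breaking, and `step_final` gives the fixed point at `2^n - 1`. A step
raises the counter by at most one and no smaller counter is optimal (`not_isOptimal_pol`), so at
least `2^n - 1` steps are needed on a graph with `O(n)` nodes. -/

theorem chain_nonneg {π : S → A} (hπ : M.IsPolicy π) (s s' : S) : 0 ≤ M.chain π s s' := by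
  unfold chain
  split_ifs with h
  · exact M.p_nonneg s _ (hπ s h) s'
  · exact zero_le_one
  · exact le_rfl

theorem chain_sum {π : S → A} (hπ : M.IsPolicy π) (s : S) : ∑ s', M.chain π s s' = 1 := by
  unfold chain
  split_ifs with h
  · exact M.p_sum s _ (hπ s h)
  · simp

theorem chain_pow_nonneg {π : S → A} (hπ : M.IsPolicy π) (k : ℕ) (s s' : S) :
    0 ≤ (M.chain π ^ k) s s' := by
  induction k generalizing s with
  | zero => simp only [pow_zero, Matrix.one_apply]; split_ifs <;> norm_num
  | succ k ih =>
    rw [pow_succ', Matrix.mul_apply]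
    exact Finset.sum_nonneg fun x _ => mul_nonneg (M.chain_nonneg hπ s x) (ih x)

theorem chain_pow_le_of_superharmonic {π : S → A} (hπ : M.IsPolicy π) {v : S → ℝ}
    (hv : ∀ s, 0 ≤ v s) (ht : 1 ≤ v M.target) (h : ∀ s, ∑ s', M.chain π s s' * v s' ≤ v s)
    (k : ℕ) (s : S) : (M.chain π ^ k) s M.target ≤ v s := by
  induction k generalizing s with
  | zero =>
    simp only [pow_zero, Matrix.one_apply]
    split_ifs with hs
    · exact hs ▸ ht
    · exact hv s
  | succ k ih =>
    rw [pow_succ', Matrix.mul_apply]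
    exact (Finset.sum_le_sum fun x _ =>
      mul_le_mul_of_nonneg_left (ih x) (M.chain_nonneg hπ s x)).trans (h s)

/-- The source of all upper bounds on values: a nonnegative superharmonic function that is at least
one at the target dominates every finite-horizon reaching probability, by peeling off the first
step. -/
theorem val_le_of_superharmonic {π : S → A} (hπ : M.IsPolicy π) {v : S → ℝ}
    (hv : ∀ s, 0 ≤ v s) (ht : 1 ≤ v M.target) (h : ∀ s, ∑ s', M.chain π s s' * v s' ≤ v s)
    (s : S) : M.val π s ≤ v s :=
  ciSup_le fun k => M.chain_pow_le_of_superharmonic hπ hv ht h k s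

theorem chain_pow_le_one {π : S → A} (hπ : M.IsPolicy π) (k : ℕ) (s : S) :
    (M.chain π ^ k) s M.target ≤ 1 :=
  M.chain_pow_le_of_superharmonic hπ (v := fun _ => 1) (fun _ => zero_le_one) le_rfl
    (fun s => by simp [M.chain_sum hπ s]) k s

theorem bddAbove_chain_pow {π : S → A} (hπ : M.IsPolicy π) (s : S) :
    BddAbove (Set.range fun k : ℕ => (M.chain π ^ k) s M.target) :=
  ⟨1, by rintro _ ⟨k, rfl⟩; exact M.chain_pow_le_one hπ k s⟩

theorem val_nonneg {π : S → A} (hπ : M.IsPolicy π) (s : S) : 0 ≤ M.val π s :=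
  (M.chain_pow_nonneg hπ 0 s M.target).trans (le_ciSup (M.bddAbove_chain_pow hπ s) 0)

theorem chain_pow_of_sink (π : S → A) {s : S} (hs : M.act s = ∅) (k : ℕ) (s' : S) :
    (M.chain π ^ k) s s' = if s' = s then 1 else 0 := by
  induction k with
  | zero => simp [Matrix.one_apply, eq_comm]
  | succ k ih =>
    have hrow : ∀ x, M.chain π s x = if x = s then 1 else 0 := fun x => by simp [chain, hs]
    simp only [pow_succ', Matrix.mul_apply, hrow, ite_mul, one_mul, zero_mul, Finset.sum_ite_eq',
      Finset.mem_univ, if_true, ih]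

theorem val_of_sink (π : S → A) {s : S} (hs : M.act s = ∅) :
    M.val π s = if M.target = s then 1 else 0 := by
  simp [val, M.chain_pow_of_sink π hs]

theorem val_target (π : S → A) : M.val π M.target = 1 := by
  simp [M.val_of_sink π M.target_sink]

theorem tendsto_val {π : S → A} (hπ : M.IsPolicy π) (s : S) :
    Filter.Tendsto (fun k : ℕ => (M.chain π ^ k) s M.target) Filter.atTop (nhds (M.val π s)) := by
  refine tendsto_atTop_ciSup (monotone_nat_of_le_succ fun k => ?_) (M.bddAbove_chain_pow hπ s)
  rw [pow_succ, Matrix.mul_apply]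
  have h1 : M.chain π M.target M.target = 1 := by
    have := M.chain_pow_of_sink π M.target_sink 1 M.target
    simpa using this
  calc (M.chain π ^ k) s M.target
      = (M.chain π ^ k) s M.target * M.chain π M.target M.target := by rw [h1, mul_one]
    _ ≤ _ := Finset.single_le_sum (f := fun x => (M.chain π ^ k) s x * M.chain π x M.target)
        (fun x _ => mul_nonneg (M.chain_pow_nonneg hπ k s x) (M.chain_nonneg hπ x _))
        (Finset.mem_univ _)

theorem val_harmonic {π : S → A} (hπ : M.IsPolicy π) (s : S) :
    M.val π s = ∑ s', M.chain π s s' * M.val π s' := by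
  have h1 := (M.tendsto_val hπ s).comp (Filter.tendsto_add_atTop_nat 1)
  have h2 : Filter.Tendsto (fun k : ℕ => ∑ s', M.chain π s s' * (M.chain π ^ k) s' M.target)
      Filter.atTop (nhds (∑ s', M.chain π s s' * M.val π s')) :=
    tendsto_finsetSum _ fun x _ => (M.tendsto_val hπ x).const_mul _
  refine tendsto_nhds_unique h1 (h2.congr fun k => ?_)
  simp only [Function.comp, pow_succ', Matrix.mul_apply]

theorem appeal_self {π : S → A} (hπ : M.IsPolicy π) {s : S} (hs : (M.act s).Nonempty) :
    M.appeal π s (π s) = M.val π s := by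
  rw [M.val_harmonic hπ s, appeal]
  simp [chain, hs]

/-- Without switchable states the value of `π` is superharmonic for the chain of every other policy.
-/
theorem isOptimal_of_not_switchable {π : S → A} (hπ : M.IsPolicy π)
    (h : ∀ s, ¬ M.Switchable π s) : M.IsOptimal π := by
  refine ⟨hπ, fun π' hπ' s => M.val_le_of_superharmonic hπ' (M.val_nonneg hπ)
    (M.val_target π).ge (fun s => ?_) s⟩
  by_cases hs : (M.act s).Nonempty
  · have := h s
    simp only [Switchable, not_exists, not_and, not_lt] at this
    simpa [chain, hs, appeal] using this _ (hπ' s hs)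
  · simp [chain, hs]

theorem isOptimal_of_greedyStep_self {π : S → A} (hπ : M.IsPolicy π) (h : M.GreedyStep π π) :
    M.IsOptimal π := by
  refine M.isOptimal_of_not_switchable hπ fun s hs => ?_
  obtain ⟨a, ha, hlt⟩ := hs
  have h1 := ((h s).1 ⟨a, ha, hlt⟩).2 a ha
  rw [M.appeal_self hπ ⟨a, ha⟩] at h1
  exact absurd hlt h1.not_gt

end ReachabilityMDP

/-- A finite graph in which following the edge `a` at `s` loses half of the probability mass
`cost s a` times; the lost mass goes to the sink `dead`.  The edge is followed with probability
`rate s a` in each step, and otherwise the state does not change. -/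
structure LossyGraph (S A : Type) where
  act : S → Finset A
  dest : S → A → S
  cost : S → A → ℕ
  rate : S → A → ℝ
  rate_pos : ∀ s a, 0 < rate s a
  rate_le_one : ∀ s a, rate s a ≤ 1
  target : S
  dead : S
  target_sink : act target = ∅
  dead_sink : act dead = ∅
  target_ne_dead : target ≠ dead

/-! ### Values of lossy graphs as powers of one half, and their greedy steps -/

namespace LossyGraph

variable {S A : Type} [Fintype S] [DecidableEq S] (G : LossyGraph S A)

noncomputable def toMDP : ReachabilityMDP S A where
  act := G.act
  p s a s' := (1 - G.rate s a) * (if s' = s then 1 else 0) +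
    G.rate s a * (1 / 2) ^ G.cost s a * (if s' = G.dest s a then 1 else 0) +
    G.rate s a * (1 - (1 / 2) ^ G.cost s a) * (if s' = G.dead then 1 else 0)
  p_nonneg s a _ s' := by
    have h1 := G.rate_pos s a
    have h2 := G.rate_le_one s a
    have h3 : (1 / 2 : ℝ) ^ G.cost s a ≤ 1 := pow_le_one₀ (by norm_num) (by norm_num)
    have h4 : (0 : ℝ) ≤ 1 - G.rate s a := by linarith
    have h5 : (0 : ℝ) ≤ 1 - (1 / 2) ^ G.cost s a := by linarith
    have h6 : ∀ P : Prop, [Decidable P] → (0 : ℝ) ≤ if P then 1 else 0 := fun P _ => by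
      split_ifs <;> norm_num
    have := h6 (s' = s)
    have := h6 (s' = G.dest s a)
    have := h6 (s' = G.dead)
    positivity
  p_sum s a _ := by
    simp only [Finset.sum_add_distrib, ← Finset.mul_sum, Finset.sum_ite_eq', Finset.mem_univ,
      if_true]
    ring
  target := G.target
  target_sink := G.target_sink

theorem val_dead (π : S → A) : G.toMDP.val π G.dead = 0 := by
  rw [G.toMDP.val_of_sink π G.dead_sink]
  exact if_neg G.target_ne_dead

theorem appeal_eq (π : S → A) (s : S) (a : A) :
    G.toMDP.appeal π s a = (1 - G.rate s a) * G.toMDP.val π s +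
      G.rate s a * ((1 / 2) ^ G.cost s a * G.toMDP.val π (G.dest s a)) := by
  have h := G.val_dead π
  unfold ReachabilityMDP.appeal
  generalize G.toMDP.val π = v at h ⊢
  simp only [toMDP, add_mul, Finset.sum_add_distrib, mul_assoc, ← Finset.mul_sum, ite_mul,
    one_mul, zero_mul, Finset.sum_ite_eq', Finset.mem_univ, if_true, h]
  ring

/-- Staying put only delays, so the positive rate cancels from the harmonic equation. -/
theorem val_eq_dest {π : S → A} (hπ : G.toMDP.IsPolicy π) {s : S} (hs : (G.act s).Nonempty) :
    G.toMDP.val π s = (1 / 2) ^ G.cost s (π s) * G.toMDP.val π (G.dest s (π s)) := by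
  have h1 := G.toMDP.appeal_self hπ (s := s) hs
  rw [appeal_eq] at h1
  have h2 := G.rate_pos s (π s)
  have h3 : G.rate s (π s) * G.toMDP.val π s = G.rate s (π s) *
    ((1 / 2) ^ G.cost s (π s) * G.toMDP.val π (G.dest s (π s))) := by linarith
  exact mul_left_cancel₀ h2.ne' h3

/-- `D` is the length of the path that `π` takes from each state to the target. -/
structure IsDist (π : S → A) (D : S → ℕ) : Prop where
  mem : ∀ s, (G.act s).Nonempty → π s ∈ G.act s
  target : D G.target = 0
  eq : ∀ s, (G.act s).Nonempty → D s = G.cost s (π s) + D (G.dest s (π s))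

/-- Every edge has positive cost and does not lead to a sink other than the target. -/
structure Proper : Prop where
  cost_pos : ∀ s, ∀ a ∈ G.act s, 0 < G.cost s a
  dest : ∀ s, ∀ a ∈ G.act s, G.dest s a = G.target ∨ (G.act (G.dest s a)).Nonempty

variable {G}

theorem IsDist.isPolicy {π : S → A} {D : S → ℕ} (h : G.IsDist π D) : G.toMDP.IsPolicy π := h.mem

/-- Positive costs make `D` decrease along the path, so it cannot cycle and must end at the target.
-/
theorem IsDist.val_eq (hG : G.Proper) {π : S → A} {D : S → ℕ} (h : G.IsDist π D) (s : S)
    (hs : s = G.target ∨ (G.act s).Nonempty) : G.toMDP.val π s = (1 / 2) ^ D s := by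
  induction hd : D s using Nat.strong_induction_on generalizing s with
  | _ d ih =>
    rcases hs with rfl | hs
    · rw [← hd, h.target, pow_zero]
      exact G.toMDP.val_target π
    · have h1 := h.eq s hs
      have h2 := hG.cost_pos s _ (h.mem s hs)
      rw [G.val_eq_dest h.isPolicy hs, ih _ (by omega) _ (hG.dest s _ (h.mem s hs)) rfl, ← pow_add,
        ← h1, hd]

theorem IsDist.appeal_eq (hG : G.Proper) {π : S → A} {D : S → ℕ} (h : G.IsDist π D) {s : S} {a : A}
    (ha : a ∈ G.act s) : G.toMDP.appeal π s a =
      (1 / 2) ^ D s + G.rate s a * ((1 / 2) ^ (G.cost s a + D (G.dest s a)) - (1 / 2) ^ D s) := by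
  rw [LossyGraph.appeal_eq, h.val_eq hG s (.inr ⟨a, ha⟩), h.val_eq hG _ (hG.dest s a ha), pow_add]
  ring

theorem half_pow_le {a b : ℕ} (h : a ≤ b) : (1 / 2 : ℝ) ^ b ≤ (1 / 2) ^ a :=
  pow_le_pow_of_le_one (by norm_num) (by norm_num) h

theorem half_pow_lt {a b : ℕ} (h : a < b) : (1 / 2 : ℝ) ^ b < (1 / 2) ^ a :=
  pow_lt_pow_right_of_lt_one₀ (by norm_num) (by norm_num) h

/-- No edge shortens the path, so a greedy step keeps the action. -/
theorem IsDist.greedy_eq_self (hG : G.Proper) {π π' : S → A} {D : S → ℕ} (h : G.IsDist π D)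
    (hstep : G.toMDP.GreedyStep π π') {s : S}
    (hs : ∀ a ∈ G.act s, D s ≤ G.cost s a + D (G.dest s a)) : π' s = π s := by
  refine (hstep s).2 ?_
  rintro ⟨a, ha, hlt⟩
  rw [h.appeal_eq hG ha, h.val_eq hG s (.inr ⟨a, ha⟩)] at hlt
  have h1 := half_pow_le (hs a ha)
  have h2 := G.rate_pos s a
  nlinarith

/-- Some edge of rate one shortens the path, and `a₀` is the best of these: a greedy step switches
to `a₀`, as the edges of small rate are less appealing. -/
theorem IsDist.greedy_eq_fast (hG : G.Proper) {π π' : S → A} {D : S → ℕ} (h : G.IsDist π D)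
    (hstep : G.toMDP.GreedyStep π π') {s : S} {a₀ : A} (ha₀ : a₀ ∈ G.act s)
    (hr : G.rate s a₀ = 1) (himp : G.cost s a₀ + D (G.dest s a₀) < D s)
    (hs : ∀ a ∈ G.act s, a ≠ a₀ → G.rate s a < (1 / 2) ^ D s ∨
      (G.rate s a = 1 ∧ G.cost s a₀ + D (G.dest s a₀) < G.cost s a + D (G.dest s a))) :
    π' s = a₀ := by
  have happ := h.appeal_eq hG ha₀
  rw [hr, one_mul, add_sub_cancel] at happ
  have hsw : G.toMDP.Switchable π s := ⟨a₀, ha₀, by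
    rw [happ, h.val_eq hG s (.inr ⟨a₀, ha₀⟩)]
    exact half_pow_lt himp⟩
  obtain ⟨hmem, hmax⟩ := (hstep s).1 hsw
  by_contra hne
  have h1 := hmax a₀ ha₀
  rw [happ, h.appeal_eq hG hmem] at h1
  rcases hs _ hmem hne with h2 | ⟨h2, h3⟩
  · have h4 : (1 / 2 : ℝ) ^ (G.cost s (π' s) + D (G.dest s (π' s))) ≤ 1 :=
      pow_le_one₀ (by norm_num) (by norm_num)
    -- Shortening the path by at least one at least doubles the value, so the fast gain is at least
    -- `(1 / 2) ^ D s`; a slow gain is at most its rate, which is smaller.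
    have h5 := half_pow_le himp
    rw [pow_succ] at h5
    have h6 := G.rate_pos s (π' s)
    have h7 : (0 : ℝ) < (1 / 2) ^ D s := by positivity
    have h5' : (1 / 2 : ℝ) ^ D s * 2 ≤ (1 / 2) ^ (G.cost s a₀ + D (G.dest s a₀)) := by linarith
    nlinarith
  · rw [h2, one_mul, add_sub_cancel] at h1
    exact absurd (half_pow_lt h3) h1.not_gt

/-- No edge of rate one shortens the path, but edges of rate `r` do, and `a₀` is the best of these:
a greedy step switches to `a₀`. -/
theorem IsDist.greedy_eq_slow (hG : G.Proper) {π π' : S → A} {D : S → ℕ} (h : G.IsDist π D)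
    (hstep : G.toMDP.GreedyStep π π') {s : S} {a₀ : A} (ha₀ : a₀ ∈ G.act s)
    (himp : G.cost s a₀ + D (G.dest s a₀) < D s)
    (hs : ∀ a ∈ G.act s, a ≠ a₀ → D s ≤ G.cost s a + D (G.dest s a) ∨
      (G.rate s a = G.rate s a₀ ∧
        G.cost s a₀ + D (G.dest s a₀) < G.cost s a + D (G.dest s a))) :
    π' s = a₀ := by
  have hr := G.rate_pos s a₀
  have himp' := half_pow_lt himp
  have hsw : G.toMDP.Switchable π s := ⟨a₀, ha₀, by
    rw [h.appeal_eq hG ha₀, h.val_eq hG s (.inr ⟨a₀, ha₀⟩)]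
    nlinarith⟩
  obtain ⟨hmem, hmax⟩ := (hstep s).1 hsw
  by_contra hne
  have h1 := hmax a₀ ha₀
  rw [h.appeal_eq hG ha₀, h.appeal_eq hG hmem] at h1
  rcases hs _ hmem hne with h2 | ⟨h2, h3⟩
  · have h4 := half_pow_le h2
    have h5 := G.rate_pos s (π' s)
    nlinarith
  · have h4 := half_pow_lt h3
    rw [h2] at h1
    nlinarith

end LossyGraph

/-! ### Arithmetic of binary increments -/

namespace BinaryCounter

/-- `B` with its lowest `k` bits cleared. -/
def trunc (B k : ℕ) : ℕ := B / 2 ^ k * 2 ^ k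

/-- The least set bit of `B` at or above `k`, or `n` if there is none below `n` and `k ≤ n`. -/
def nextSet (n B k : ℕ) : ℕ :=
  Nat.find (p := fun m => k ≤ m ∧ (n ≤ m ∨ B.testBit m = true))
    ⟨max k n, le_max_left _ _, .inl (le_max_right _ _)⟩

/-- The least unset bit of `B`, or `n` if there is none below `n`. -/
def low (n B : ℕ) : ℕ :=
  Nat.find (p := fun m => n ≤ m ∨ B.testBit m = false) ⟨n, .inl le_rfl⟩

theorem trunc_zero (B : ℕ) : trunc B 0 = B := by simp [trunc]

theorem trunc_le (B k : ℕ) : trunc B k ≤ B := Nat.div_mul_le_self _ _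

theorem lt_trunc_add (B k : ℕ) : B < trunc B k + 2 ^ k := by
  have := Nat.lt_div_mul_add (a := B) (b := 2 ^ k) (by positivity)
  exact this

theorem trunc_succ (B k : ℕ) :
    trunc B k = trunc B (k + 1) + if B.testBit k then 2 ^ k else 0 := by
  have h1 : B / 2 ^ (k + 1) = B / 2 ^ k / 2 := by rw [pow_succ, Nat.div_div_eq_div_mul]
  have h2 : B.testBit k = decide (B / 2 ^ k % 2 = 1) := Nat.testBit_eq_decide_div_mod_eq
  rw [trunc, trunc, h1, h2]
  simp only [decide_eq_true_eq]
  generalize B / 2 ^ k = q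
  have h3 := Nat.div_add_mod q 2
  split_ifs with h
  · rw [h] at h3
    nth_rewrite 1 [← h3]
    ring
  · have h4 : q % 2 = 0 := by omega
    rw [h4] at h3
    nth_rewrite 1 [← h3]
    ring

theorem trunc_anti (B : ℕ) {k m : ℕ} (h : k ≤ m) : trunc B m ≤ trunc B k := by
  induction m, h using Nat.le_induction with
  | base => exact le_rfl
  | succ m _ ih => have := trunc_succ B m; omega

theorem trunc_top {n B : ℕ} (hB : B < 2 ^ n) : trunc B n = 0 := by
  simp [trunc, Nat.div_eq_of_lt hB]

theorem trunc_add_le {n B k : ℕ} (hB : B < 2 ^ n) (hk : k ≤ n) : trunc B k + 2 ^ k ≤ 2 ^ n := by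
  have h1 : B / 2 ^ k < 2 ^ (n - k) := by
    rw [Nat.div_lt_iff_lt_mul (by positivity), ← pow_add, Nat.sub_add_cancel hk]
    exact hB
  calc trunc B k + 2 ^ k = (B / 2 ^ k + 1) * 2 ^ k := by rw [trunc]; ring
    _ ≤ 2 ^ (n - k) * 2 ^ k := Nat.mul_le_mul_right _ h1
    _ = 2 ^ n := by rw [← pow_add, Nat.sub_add_cancel hk]

theorem le_nextSet (n B k : ℕ) : k ≤ nextSet n B k :=
  (Nat.find_spec (p := fun m => k ≤ m ∧ (n ≤ m ∨ B.testBit m = true)) _).1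

theorem nextSet_le {n B k m : ℕ} (hkm : k ≤ m) (hm : n ≤ m ∨ B.testBit m = true) :
    nextSet n B k ≤ m :=
  Nat.find_min' _ ⟨hkm, hm⟩

theorem nextSet_le_top {n B k : ℕ} (hk : k ≤ n) : nextSet n B k ≤ n :=
  nextSet_le hk (.inl le_rfl)

theorem testBit_nextSet {n B k : ℕ} (h : nextSet n B k < n) : B.testBit (nextSet n B k) = true :=
  (Nat.find_spec (p := fun m => k ≤ m ∧ (n ≤ m ∨ B.testBit m = true)) _).2.resolve_left h.not_ge

theorem testBit_of_lt_nextSet {n B k m : ℕ} (hkm : k ≤ m) (h : m < nextSet n B k) :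
    B.testBit m = false := by
  by_contra hb
  exact absurd (nextSet_le hkm (.inr (by simpa using hb))) h.not_ge

theorem trunc_eq_of_le_nextSet {n B k m : ℕ} (hkm : k ≤ m) (h : m ≤ nextSet n B k) :
    trunc B m = trunc B k := by
  induction m, hkm using Nat.le_induction with
  | base => rfl
  | succ m hm ih =>
    have h1 := trunc_succ B m
    rw [testBit_of_lt_nextSet hm h] at h1
    rw [← ih (by omega), h1]
    simp

theorem trunc_lt_of_nextSet_lt {n B k m : ℕ} (h : nextSet n B k < m) (hm : m ≤ n) :
    trunc B m < trunc B k := by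
  have h1 := trunc_succ B (nextSet n B k)
  rw [testBit_nextSet (h.trans_le hm), trunc_eq_of_le_nextSet (le_nextSet n B k) le_rfl] at h1
  have h2 := trunc_anti B (Nat.succ_le_of_lt h)
  have h3 : 0 < 2 ^ nextSet n B k := by positivity
  simp only [if_true, Nat.succ_eq_add_one] at h1 h2
  omega

/-- A position other than the next set bit is unset, or lies above that bit. -/
theorem ne_nextSet {n B k m : ℕ} (hkm : k ≤ m) (hm : m ≤ n) (hne : m ≠ nextSet n B k)
    (hk : k ≤ n) :
    trunc B m < trunc B k ∨ (trunc B m = trunc B k ∧ m < n ∧ B.testBit m = false) := by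
  rcases lt_or_gt_of_ne hne with h | h
  · exact .inr ⟨trunc_eq_of_le_nextSet hkm h.le, h.trans_le (nextSet_le_top hk),
      testBit_of_lt_nextSet hkm h⟩
  · exact .inl (trunc_lt_of_nextSet_lt h hm)

theorem low_le (n B : ℕ) : low n B ≤ n := Nat.find_min' _ (.inl le_rfl)

theorem testBit_low {n B : ℕ} (h : low n B < n) : B.testBit (low n B) = false :=
  (Nat.find_spec (p := fun m => n ≤ m ∨ B.testBit m = false) _).resolve_left h.not_ge

theorem testBit_of_lt_low {n B m : ℕ} (h : m < low n B) : B.testBit m = true := by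
  have := Nat.find_min _ h
  simpa using (not_or.1 this).2

/-- The `k` lowest bits are all ones, so adding one carries out of them. This equality is what makes
the closed bits below `low n B` lose to the hub by exactly one after an increment. -/
theorem trunc_of_le_low {n B k : ℕ} (h : k ≤ low n B) : trunc B k + 2 ^ k = B + 1 := by
  induction k with
  | zero => simp [trunc_zero]
  | succ k ih =>
    have h1 := trunc_succ B k
    rw [testBit_of_lt_low h] at h1
    have := ih (by omega)
    rw [pow_succ]
    simp only [if_true] at h1
    omega

theorem succ_eq {n B : ℕ} (h : low n B < n) :
    B + 1 = trunc B (low n B + 1) + 2 ^ low n B := by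
  have h1 := trunc_succ B (low n B)
  rw [testBit_low h] at h1
  have h2 := trunc_of_le_low (n := n) (B := B) le_rfl
  simp only [Bool.false_eq_true, if_false] at h1
  omega

theorem low_lt {n B : ℕ} (hB : B + 1 < 2 ^ n) : low n B < n := by
  by_contra h
  have h1 := low_le n B
  have h2 := trunc_of_le_low (n := n) (B := B) (k := n) (by omega)
  omega

theorem succ_lt {n B : ℕ} (hB : B < 2 ^ n) (h : low n B < n) : B + 1 < 2 ^ n := by
  have h1 := succ_eq h
  have h2 := trunc_add_le hB (k := low n B + 1) h
  have h3 : 0 < 2 ^ low n B := by positivity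
  rw [pow_succ] at h2
  omega

theorem testBit_succ {n B : ℕ} (h : low n B < n) (k : ℕ) : (B + 1).testBit k =
    if k < low n B then false else if k = low n B then true else B.testBit k := by
  have h1 := succ_eq h
  rw [trunc, mul_comm] at h1
  have h2 : 2 ^ low n B < 2 ^ (low n B + 1) := Nat.pow_lt_pow_succ (by norm_num)
  rw [h1, Nat.testBit_two_pow_mul_add _ h2]
  generalize low n B = i at *
  rcases lt_trichotomy k i with hk | rfl | hk
  · rw [if_pos (by omega), if_pos hk, Nat.testBit_two_pow_of_ne (by omega)]
  · simp
  · rw [if_neg (by omega), if_neg (by omega), if_neg (by omega), Nat.testBit_div_two_pow]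
    congr 1
    omega

theorem trunc_succ_of_low_lt {n B k : ℕ} (h : low n B < n) (hk : low n B < k) :
    trunc (B + 1) k = trunc B k := by
  have h1 := succ_eq h
  have h2 : 2 ^ low n B < 2 ^ (low n B + 1) := Nat.pow_lt_pow_succ (by norm_num)
  have h3 : (B + 1) / 2 ^ (low n B + 1) = B / 2 ^ (low n B + 1) := by
    rw [h1, trunc, mul_comm, Nat.mul_add_div (by positivity), Nat.div_eq_of_lt h2, add_zero]
  obtain ⟨d, rfl⟩ := Nat.exists_eq_add_of_le (Nat.succ_le_of_lt hk)
  rw [trunc, trunc, Nat.succ_eq_add_one, pow_add, ← Nat.div_div_eq_div_mul, h3,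
    Nat.div_div_eq_div_mul]

theorem nextSet_succ_of_le_low {n B k : ℕ} (h : low n B < n) (hk : k ≤ low n B) :
    nextSet n (B + 1) k = low n B := by
  refine le_antisymm (nextSet_le hk (.inr ?_)) ?_
  · rw [testBit_succ h]; simp
  · by_contra hlt
    have h1 := testBit_nextSet (n := n) (B := B + 1) (k := k) (by omega)
    rw [testBit_succ h, if_pos (by omega)] at h1
    exact absurd h1 (by simp)

theorem nextSet_succ_of_low_lt {n B k : ℕ} (h : low n B < n) (hk : low n B < k) :
    nextSet n (B + 1) k = nextSet n B k := by
  have key : ∀ m, k ≤ m → (B + 1).testBit m = B.testBit m := fun m hm => by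
    rw [testBit_succ h, if_neg (by omega), if_neg (by omega)]
  unfold nextSet
  congr 1
  ext m
  constructor
  · rintro ⟨h1, h2⟩; exact ⟨h1, key m h1 ▸ h2⟩
  · rintro ⟨h1, h2⟩; exact ⟨h1, (key m h1).symm ▸ h2⟩

end BinaryCounter

/-! ### The counter graph -/

namespace BinaryCounter

/-- `high k` is the entry of bit `k`, where the path chooses between passing through `bit k` and
skipping it. The lanes are the distraction of the open bits. `pad 0` serves as the dead sink; the
other pads only adjust the number of nodes. -/
inductive Node (n r : ℕ)
  | target
  | pad (j : Fin (r + 1))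
  | hub
  | lane (l : Fin (2 * n + 1))
  | high (k : Fin n)
  | bit (k : Fin n)
  deriving DecidableEq

inductive Act
  | jump (m : ℕ)
  | take
  | toHub
  | toLane (l : ℕ)
  deriving DecidableEq

def Node.equivSum (n r : ℕ) :
    Node n r ≃ (Bool ⊕ Fin (r + 1)) ⊕ (Fin (2 * n + 1) ⊕ (Fin n ⊕ Fin n)) where
  toFun
    | .target => .inl (.inl true)
    | .hub => .inl (.inl false)
    | .pad j => .inl (.inr j)
    | .lane l => .inr (.inl l)
    | .high k => .inr (.inr (.inl k))
    | .bit k => .inr (.inr (.inr k))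
  invFun
    | .inl (.inl true) => .target
    | .inl (.inl false) => .hub
    | .inl (.inr j) => .pad j
    | .inr (.inl l) => .lane l
    | .inr (.inr (.inl k)) => .high k
    | .inr (.inr (.inr k)) => .bit k
  left_inv s := by cases s <;> rfl
  right_inv s := by rcases s with ((_ | _) | _) | (_ | (_ | _)) <;> rfl

instance Node.instFintype (n r : ℕ) : Fintype (Node n r) :=
  Fintype.ofEquiv _ (Node.equivSum n r).symm

theorem Node.card (n r : ℕ) : Fintype.card (Node n r) = 4 * n + r + 4 := by
  rw [Fintype.card_congr (Node.equivSum n r)]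
  simp only [Fintype.card_sum, Fintype.card_bool, Fintype.card_fin]
  omega

variable {n r : ℕ}

def Node.entry (m : ℕ) : Node n r := if h : m < n then .high ⟨m, h⟩ else .target

def Node.ofBit (m : ℕ) : Node n r := if h : m < n then .bit ⟨m, h⟩ else .target

def Node.ofLane (l : ℕ) : Node n r := if h : l < 2 * n + 1 then .lane ⟨l, h⟩ else .target

def act : Node n r → Finset Act
  | .target => ∅
  | .pad _ => ∅
  | .hub => (Finset.range (n + 1)).image .jump
  | .lane l => if l.val = 0 then (Finset.range (n + 1)).image .jump
      else {.toHub, .toLane (l - 1)}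
  | .high k => insert .take ((Finset.Ioc k.val n).image .jump)
  | .bit k => insert .toHub ((Finset.range (2 * k + 1)).image .toLane ∪
      (Finset.Ioc k.val n).image .jump)

/-- The hub jumps straight to a bit, whereas lane `0` jumps to its entry. The hub thus sees a newly
closed bit one iteration earlier, and this lead triggers the reset. -/
def dest : Node n r → Act → Node n r
  | _, .toHub => .hub
  | _, .toLane l => .ofLane l
  | .high k, .take => .bit k
  | _, .take => .target
  | .hub, .jump m => .ofBit m
  | _, .jump m => .entry m

/-- The leading part of the cost of an edge. -/
def major : Node n r → Act → ℕ
  | .hub, .jump m => 2 ^ m - 1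
  | .lane _, .jump m => 2 ^ m - 1
  | .high k, .jump m => 2 ^ m - 2 ^ k.val
  | .bit k, .jump m => 2 ^ m - 2 ^ (k.val + 1)
  | _, _ => 0

/-- The lower-order part of the cost of an edge. -/
def minor : Node n r → Act → ℕ
  | .hub, .jump m => if m < n then 2 * m + 2 else 2 * n + 1
  | .lane _, .jump m => 2 * m + 1
  | .lane _, .toHub => 8 * n + 8
  | .high k, .jump m => 2 * (m - k) + 1
  | .bit _, .toHub => 4 * n + 2
  | .bit _, .toLane l => 4 * n + 1 - 2 * l
  | .bit k, .jump m => 2 * (m - k - 1) + 1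
  | _, _ => 1

/-- The edges that close a bit are followed with tiny probability only. -/
def slow : Node n r → Act → Bool
  | .bit _, .jump _ => true
  | _, _ => false

/-- The weight of the leading part of a cost; it exceeds all lower-order parts. -/
def scale (n : ℕ) : ℕ := 100 * (n + 1)

noncomputable def graph (n r : ℕ) : LossyGraph (Node n r) Act where
  act := act
  dest := dest
  cost s a := scale n * major s a + minor s a
  -- The exponent exceeds every path length that occurs, by `distMajor_le` and `distMinor_lt`.
  rate s a := if slow s a then (1 / 2) ^ (scale n * 2 ^ n + scale n) else 1
  rate_pos s a := by split_ifs <;> positivity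
  rate_le_one s a := by
    split_ifs
    · exact pow_le_one₀ (by norm_num) (by norm_num)
    · exact le_rfl
  target := .target
  dead := .pad 0
  target_sink := rfl
  dead_sink := rfl
  target_ne_dead := by simp

theorem mem_act_hub {a : Act} :
    a ∈ act (.hub : Node n r) ↔ ∃ m, m ≤ n ∧ a = .jump m := by
  simp [act, eq_comm]

theorem mem_act_lane_zero {l : Fin (2 * n + 1)} (hl : l.val = 0) {a : Act} :
    a ∈ act (.lane l : Node n r) ↔ ∃ m, m ≤ n ∧ a = .jump m := by
  simp [act, hl, eq_comm]

theorem mem_act_lane {l : Fin (2 * n + 1)} (hl : l.val ≠ 0) {a : Act} :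
    a ∈ act (.lane l : Node n r) ↔ a = .toHub ∨ a = .toLane (l - 1) := by
  simp [act, hl]

theorem mem_act_high {k : Fin n} {a : Act} :
    a ∈ act (.high k : Node n r) ↔ a = .take ∨ ∃ m : ℕ, (k.val < m ∧ m ≤ n) ∧ a = .jump m := by
  simp [act, eq_comm]

theorem mem_act_bit {k : Fin n} {a : Act} :
    a ∈ act (.bit k : Node n r) ↔ a = .toHub ∨ (∃ l ≤ 2 * k.val, a = .toLane l) ∨
      ∃ m : ℕ, (k.val < m ∧ m ≤ n) ∧ a = .jump m := by
  simp [act, eq_comm]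

theorem entry_eq_or (m : ℕ) : (Node.entry m : Node n r) = .target ∨
    (act (Node.entry m : Node n r)).Nonempty := by
  unfold Node.entry
  split_ifs
  · exact .inr ⟨.take, mem_act_high.2 (.inl rfl)⟩
  · exact .inl rfl

theorem ofBit_eq_or (m : ℕ) : (Node.ofBit m : Node n r) = .target ∨
    (act (Node.ofBit m : Node n r)).Nonempty := by
  unfold Node.ofBit
  split_ifs
  · exact .inr ⟨.toHub, mem_act_bit.2 (.inl rfl)⟩
  · exact .inl rfl

theorem ofLane_eq_or (l : ℕ) : (Node.ofLane l : Node n r) = .target ∨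
    (act (Node.ofLane l : Node n r)).Nonempty := by
  unfold Node.ofLane
  split_ifs with h
  · refine .inr ?_
    by_cases hl : l = 0
    · exact ⟨.jump 0, (mem_act_lane_zero hl).2 ⟨0, by omega, rfl⟩⟩
    · exact ⟨.toHub, (mem_act_lane hl).2 (.inl rfl)⟩
  · exact .inl rfl

theorem graph_proper (n r : ℕ) : (graph n r).Proper where
  cost_pos s a ha := by
    refine Nat.lt_of_lt_of_le ?_ (Nat.le_add_left _ _)
    change a ∈ act s at ha
    match s with
    | .target => simp [act] at ha
    | .pad _ => simp [act] at ha
    | .hub =>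
      obtain ⟨m, -, rfl⟩ := mem_act_hub.1 ha
      simp only [minor]
      split_ifs <;> omega
    | .lane l =>
      by_cases hl : l.val = 0
      · obtain ⟨m, -, rfl⟩ := (mem_act_lane_zero hl).1 ha
        simp only [minor]; omega
      · rcases (mem_act_lane hl).1 ha with rfl | rfl <;> simp only [minor] <;> omega
    | .high k =>
      rcases mem_act_high.1 ha with rfl | ⟨m, -, rfl⟩ <;> simp only [minor] <;> omega
    | .bit k =>
      have := k.2
      rcases mem_act_bit.1 ha with rfl | ⟨l, hl, rfl⟩ | ⟨m, -, rfl⟩ <;> simp only [minor] <;> omega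
  dest s a ha := by
    change a ∈ act s at ha
    change dest s a = .target ∨ (act (dest s a)).Nonempty
    match s with
    | .target => simp [act] at ha
    | .pad _ => simp [act] at ha
    | .hub =>
      obtain ⟨m, -, rfl⟩ := mem_act_hub.1 ha
      exact ofBit_eq_or m
    | .lane l =>
      by_cases hl : l.val = 0
      · obtain ⟨m, -, rfl⟩ := (mem_act_lane_zero hl).1 ha
        exact entry_eq_or m
      · rcases (mem_act_lane hl).1 ha with rfl | rfl
        · exact .inr ⟨.jump 0, mem_act_hub.2 ⟨0, by omega, rfl⟩⟩
        · exact ofLane_eq_or _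
    | .high k =>
      rcases mem_act_high.1 ha with rfl | ⟨m, -, rfl⟩
      · exact .inr ⟨.toHub, mem_act_bit.2 (.inl rfl)⟩
      · exact entry_eq_or m
    | .bit k =>
      rcases mem_act_bit.1 ha with rfl | ⟨l, hl, rfl⟩ | ⟨m, -, rfl⟩
      · exact .inr ⟨.jump 0, mem_act_hub.2 ⟨0, by omega, rfl⟩⟩
      · exact ofLane_eq_or _
      · exact entry_eq_or m

theorem card_act_le (s : Node n r) : (act s).card ≤ 4 * n + r + 4 := by
  match s with
  | .target => simp [act]
  | .pad _ => simp [act]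
  | .hub =>
    refine Finset.card_image_le.trans ?_
    rw [Finset.card_range]; omega
  | .lane l =>
    simp only [act]
    split_ifs
    · refine Finset.card_image_le.trans ?_
      rw [Finset.card_range]; omega
    · refine Finset.card_le_two.trans ?_
      omega
  | .high k =>
    refine (Finset.card_insert_le _ _).trans ?_
    have := (Finset.Ioc k.val n).card_image_le (f := Act.jump)
    rw [Nat.card_Ioc] at this
    omega
  | .bit k =>
    refine (Finset.card_insert_le _ _).trans ?_
    have h1 := (Finset.Ioc k.val n).card_image_le (f := Act.jump)
    have h2 := (Finset.range (2 * k.val + 1)).card_image_le (f := Act.toLane)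
    have h3 := Finset.card_union_le ((Finset.range (2 * k.val + 1)).image Act.toLane)
      ((Finset.Ioc k.val n).image Act.jump)
    rw [Nat.card_Ioc] at h1
    rw [Finset.card_range] at h2
    have := k.2
    omega

/-- In the last phase before the counter is increased, the hub and the entry of the lowest unset
bit have already noticed that this bit has been closed. -/
abbrev Late (n B t : ℕ) : Prop := t = 2 * low n B + 3

abbrev EntrySet (n B t k : ℕ) : Prop := B.testBit k = true ∨ (k = low n B ∧ Late n B t)

abbrev BitSet (n B t k : ℕ) : Prop :=
  B.testBit k = true ∨ (k = low n B ∧ 2 * low n B + 2 ≤ t)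

/-- The counter value seen by the hub. -/
def hubCount (n B t : ℕ) : ℕ := if Late n B t then B + 1 else B

/-- The truncated counter value seen at the entry of bit `m`. -/
def entryTrunc (n B t m : ℕ) : ℕ := trunc B m + if m = low n B ∧ Late n B t then 2 ^ m else 0

/-- The policy in phase `t` at counter value `B`. -/
def pol (B t : ℕ) : Node n r → Act
  | .target => .take
  | .pad _ => .take
  | .hub => .jump (nextSet n (hubCount n B t) 0)
  | .lane l => if l.val = 0 then .jump (nextSet n B 0)
      else if l.val ≤ t then .toLane (l - 1) else .toHub
  | .high k => if EntrySet n B t k then .take else .jump (nextSet n B (k + 1))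
  | .bit k => if BitSet n B t k then .jump (nextSet n B (k + 1))
      else if t = 0 then .toHub else .toLane (t - 1)

/-- The leading part of the distance to the target under `pol`. -/
def distMajor (B t : ℕ) : Node n r → ℕ
  | .target => 0
  | .pad _ => 0
  | .hub => 2 ^ n - 1 - hubCount n B t
  | .lane l => if l.val ≤ t then 2 ^ n - 1 - B else 2 ^ n - 1 - hubCount n B t
  | .high k => 2 ^ n - 2 ^ k.val - entryTrunc n B t k
  | .bit k => if BitSet n B t k then 2 ^ n - 2 ^ (k.val + 1) - trunc B (k + 1)
      else 2 ^ n - 1 - B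

/-- The lower-order part of the distance to the target under `pol`. -/
def distMinor (B t : ℕ) : Node n r → ℕ
  | .target => 0
  | .pad _ => 0
  | .hub => 2 * n + 1
  | .lane l => if l.val ≤ t then 2 * n + 1 + l else 10 * n + 9
  | .high k => 2 * (n - k) + if EntrySet n B t k then 0 else 1
  | .bit k => if BitSet n B t k then 2 * (n - k - 1) + 1 else 6 * n + 3 - t

/-- The pairs of a counter value and a phase that occur. -/
structure Valid (n B t : ℕ) : Prop where
  lt : B < 2 ^ n
  le : t ≤ 2 * low n B + 3
  le_of_top : low n B = n → t ≤ 2 * n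

def dist (B t : ℕ) (s : Node n r) : ℕ := scale n * distMajor B t s + distMinor B t s

/-! ### Bounds on the two parts of a path length -/

variable {B t : ℕ}

theorem Valid.low_lt_of_late (h : Valid n B t) (ht : Late n B t) : low n B < n := by
  refine lt_of_le_of_ne (low_le n B) fun he => ?_
  have := h.le_of_top he
  simp only [Late] at ht
  omega

/-- Ensures that the truncated subtractions in `distMajor` at the entries are exact. -/
theorem Valid.entryTrunc_add_le (h : Valid n B t) {m : ℕ} (hm : m ≤ n) :
    entryTrunc n B t m + 2 ^ m ≤ 2 ^ n := by
  unfold entryTrunc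
  split_ifs with hc
  · obtain ⟨rfl, hl⟩ := hc
    have h1 := h.low_lt_of_late hl
    have h2 := trunc_succ B (low n B)
    rw [testBit_low h1] at h2
    have h3 := trunc_add_le h.lt (k := low n B + 1) h1
    rw [pow_succ] at h3
    simp only [Bool.false_eq_true, if_false] at h2
    omega
  · exact trunc_add_le h.lt hm

theorem Valid.distMajor_entry (h : Valid n B t) {m : ℕ} (hm : m ≤ n) :
    distMajor B t (Node.entry m : Node n r) = 2 ^ n - 2 ^ m - entryTrunc n B t m := by
  unfold Node.entry
  split_ifs with hlt
  · rfl
  · obtain rfl : m = n := by omega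
    simp [distMajor]

theorem distMinor_entry_of_set {m : ℕ} (hm : m = n ∨ EntrySet n B t m) :
    distMinor B t (Node.entry m : Node n r) = 2 * (n - m) := by
  unfold Node.entry
  split_ifs with hlt
  · simp only [distMinor]
    rw [if_pos (hm.resolve_left hlt.ne)]
    rfl
  · simp only [distMinor]
    omega

theorem distMinor_entry_of_not_set {m : ℕ} (hm : m < n) (hs : ¬ EntrySet n B t m) :
    distMinor B t (Node.entry m : Node n r) = 2 * (n - m) + 1 := by
  unfold Node.entry
  rw [dif_pos hm]
  simp only [distMinor]
  rw [if_neg hs]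

theorem le_distMinor_entry (m : ℕ) :
    2 * (n - m) ≤ distMinor B t (Node.entry m : Node n r) := by
  unfold Node.entry
  split_ifs with hlt
  · simp only [distMinor]; omega
  · simp only [distMinor]; omega

theorem distMajor_le (s : Node n r) : distMajor B t s ≤ 2 ^ n := by
  cases s <;> simp only [distMajor] <;> (try split_ifs) <;>
    first | exact Nat.zero_le _ | exact Nat.sub_le _ _ |
      exact (Nat.sub_le _ _).trans (Nat.sub_le _ _)

theorem distMinor_le (s : Node n r) : distMinor B t s ≤ 10 * n + 9 := by
  cases s <;> simp only [distMinor] <;> (try split_ifs) <;> omega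

theorem minor_le {s : Node n r} {a : Act} (ha : a ∈ act s) : minor s a ≤ 8 * n + 8 := by
  match s with
  | .target => simp [act] at ha
  | .pad _ => simp [act] at ha
  | .hub =>
    obtain ⟨m, -, rfl⟩ := mem_act_hub.1 ha
    simp only [minor]
    split_ifs <;> omega
  | .lane l =>
    by_cases hl : l.val = 0
    · obtain ⟨m, hm, rfl⟩ := (mem_act_lane_zero hl).1 ha
      simp only [minor]; omega
    · rcases (mem_act_lane hl).1 ha with rfl | rfl <;> simp only [minor] <;> omega
  | .high k =>
    rcases mem_act_high.1 ha with rfl | ⟨m, hm, rfl⟩ <;> simp only [minor] <;> omega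
  | .bit k =>
    rcases mem_act_bit.1 ha with rfl | ⟨l, hl, rfl⟩ | ⟨m, hm, rfl⟩ <;> simp only [minor] <;> omega

theorem scale_lt_of_lex {a b c d : ℕ} (h : a < c ∨ (a = c ∧ b < d)) (hb : b < scale n) :
    scale n * a + b < scale n * c + d := by
  rcases h with h | ⟨rfl, h⟩
  · have := Nat.mul_le_mul_left (scale n) (Nat.succ_le_of_lt h)
    rw [Nat.succ_eq_add_one, mul_add] at this
    omega
  · omega

theorem scale_le_of_lex {a b c d : ℕ} (h : a < c ∨ (a = c ∧ b ≤ d)) (hb : b < scale n) :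
    scale n * a + b ≤ scale n * c + d := by
  rcases h with h | ⟨rfl, h⟩
  · exact (scale_lt_of_lex (.inl h) hb).le
  · omega

/-- The leading part of the distance to the target when `a` is taken at `s`. -/
def viaMajor (B t : ℕ) (s : Node n r) (a : Act) : ℕ := major s a + distMajor B t (dest s a)

/-- The lower-order part of the distance to the target when `a` is taken at `s`. -/
def viaMinor (B t : ℕ) (s : Node n r) (a : Act) : ℕ := minor s a + distMinor B t (dest s a)

theorem cost_add_dist (s : Node n r) (a : Act) :
    (graph n r).cost s a + dist B t ((graph n r).dest s a) =
      scale n * viaMajor B t s a + viaMinor B t s a := by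
  simp only [graph, dist, viaMajor, viaMinor]
  ring

theorem viaMinor_lt {s : Node n r} {a : Act} (ha : a ∈ act s) : viaMinor B t s a < scale n := by
  have h1 := minor_le ha
  have h2 := distMinor_le (B := B) (t := t) (dest s a)
  simp only [viaMinor, scale]
  omega

theorem distMinor_lt (s : Node n r) : distMinor B t s < scale n := by
  have h2 := distMinor_le (B := B) (t := t) s
  simp only [scale]
  omega

/-! ### Greedy steps decided by lexicographic comparison -/

section Step

variable {π' : Node n r → Act} {s : Node n r}
  (hd : (graph n r).IsDist (pol B t) (dist B t))
  (hstep : (graph n r).toMDP.GreedyStep (pol B t) π')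

include hd hstep

theorem step_keep (hs : ∀ a ∈ act s, distMajor B t s < viaMajor B t s a ∨
    (distMajor B t s = viaMajor B t s a ∧ distMinor B t s ≤ viaMinor B t s a)) :
    π' s = pol B t s := by
  refine hd.greedy_eq_self (graph_proper n r) hstep fun a ha => ?_
  rw [cost_add_dist]
  exact scale_le_of_lex (hs a ha) (distMinor_lt s)

theorem step_fast {a₀ : Act} (ha₀ : a₀ ∈ act s) (hslow : slow s a₀ = false)
    (himp : viaMajor B t s a₀ < distMajor B t s ∨
      (viaMajor B t s a₀ = distMajor B t s ∧ viaMinor B t s a₀ < distMinor B t s))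
    (hs : ∀ a ∈ act s, a ≠ a₀ → slow s a = true ∨ (slow s a = false ∧
      (viaMajor B t s a₀ < viaMajor B t s a ∨
        (viaMajor B t s a₀ = viaMajor B t s a ∧ viaMinor B t s a₀ < viaMinor B t s a)))) :
    π' s = a₀ := by
  refine hd.greedy_eq_fast (graph_proper n r) hstep ha₀ (by simp [graph, hslow]) ?_
    fun a ha hne => ?_
  · rw [cost_add_dist]
    exact scale_lt_of_lex himp (viaMinor_lt ha₀)
  · rcases hs a ha hne with h | ⟨h1, h2⟩
    · left
      simp only [graph, h, if_true]
      refine LossyGraph.half_pow_lt ?_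
      have h1 := Nat.mul_le_mul_left (scale n) (distMajor_le (B := B) (t := t) s)
      have h2 := distMinor_lt (B := B) (t := t) s
      rw [dist]
      omega
    · right
      refine ⟨by simp [graph, h1], ?_⟩
      rw [cost_add_dist, cost_add_dist]
      exact scale_lt_of_lex h2 (viaMinor_lt ha₀)

theorem step_slow {a₀ : Act} (ha₀ : a₀ ∈ act s) (hslow : slow s a₀ = true)
    (himp : viaMajor B t s a₀ < distMajor B t s ∨
      (viaMajor B t s a₀ = distMajor B t s ∧ viaMinor B t s a₀ < distMinor B t s))
    (hs : ∀ a ∈ act s, a ≠ a₀ → (distMajor B t s < viaMajor B t s a ∨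
      (distMajor B t s = viaMajor B t s a ∧ distMinor B t s ≤ viaMinor B t s a)) ∨
      (slow s a = true ∧ (viaMajor B t s a₀ < viaMajor B t s a ∨
        (viaMajor B t s a₀ = viaMajor B t s a ∧ viaMinor B t s a₀ < viaMinor B t s a)))) :
    π' s = a₀ := by
  refine hd.greedy_eq_slow (graph_proper n r) hstep ha₀ ?_ fun a ha hne => ?_
  · rw [cost_add_dist]
    exact scale_lt_of_lex himp (viaMinor_lt ha₀)
  · rcases hs a ha hne with h | ⟨h1, h2⟩
    · left
      rw [cost_add_dist]
      exact scale_le_of_lex h (distMinor_lt s)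
    · right
      refine ⟨by simp [graph, h1, hslow], ?_⟩
      rw [cost_add_dist, cost_add_dist]
      exact scale_lt_of_lex h2 (viaMinor_lt ha₀)

end Step

end BinaryCounter

/-! ### Path lengths through each edge and under each phase policy -/

namespace BinaryCounter

variable {n r B t : ℕ}

theorem ofLane_of_le {l : ℕ} (h : l < 2 * n + 1) : (Node.ofLane l : Node n r) = .lane ⟨l, h⟩ :=
  dif_pos h

theorem ofBit_of_lt {m : ℕ} (h : m < n) : (Node.ofBit m : Node n r) = .bit ⟨m, h⟩ := dif_pos h

theorem entryTrunc_of_ne {m : ℕ} (h : ¬ (m = low n B ∧ Late n B t)) :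
    entryTrunc n B t m = trunc B m := by
  rw [entryTrunc, if_neg h, add_zero]

theorem entryTrunc_low (h : Late n B t) : entryTrunc n B t (low n B) = B + 1 := by
  rw [entryTrunc, if_pos ⟨rfl, h⟩, trunc_of_le_low le_rfl]

theorem Valid.entryTrunc_of_set (h : Valid n B t) {m : ℕ} (hs : EntrySet n B t m) :
    entryTrunc n B t m = trunc B (m + 1) + 2 ^ m := by
  rcases hs with hs | ⟨rfl, hl⟩
  · rw [entryTrunc_of_ne, trunc_succ, if_pos hs]
    rintro ⟨rfl, hl⟩
    rw [testBit_low (h.low_lt_of_late hl)] at hs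
    exact absurd hs (by simp)
  · rw [entryTrunc_low hl, succ_eq (h.low_lt_of_late hl)]

theorem entryTrunc_of_not_set {m : ℕ} (hs : ¬ EntrySet n B t m) :
    entryTrunc n B t m = trunc B (m + 1) := by
  simp only [EntrySet, not_or] at hs
  rw [entryTrunc_of_ne hs.2, trunc_succ, if_neg hs.1, add_zero]

theorem Valid.nextSet_ne_low (h : Valid n B t) (k : ℕ) (hl : Late n B t) :
    nextSet n B k ≠ low n B := fun he => by
  have h1 := h.low_lt_of_late hl
  have h2 := testBit_nextSet (n := n) (B := B) (k := k) (by omega)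
  rw [he, testBit_low h1] at h2
  exact absurd h2 (by simp)

theorem Valid.entryTrunc_nextSet (h : Valid n B t) (k : ℕ) :
    entryTrunc n B t (nextSet n B k) = trunc B k := by
  rw [entryTrunc_of_ne fun hc => h.nextSet_ne_low k hc.2 hc.1,
    trunc_eq_of_le_nextSet (le_nextSet n B k) le_rfl]

theorem distMinor_entry_nextSet {k : ℕ} (hk : k ≤ n) :
    distMinor B t (Node.entry (nextSet n B k) : Node n r) = 2 * (n - nextSet n B k) :=
  distMinor_entry_of_set <| (nextSet_le_top (n := n) (B := B) hk).eq_or_lt.imp_right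
    fun h => .inl (testBit_nextSet h)

theorem BitSet.of_entrySet {k : ℕ} (h : EntrySet n B t k) : BitSet n B t k :=
  h.imp_right fun h => ⟨h.1, by have := h.2; simp only [Late] at this; omega⟩

theorem hubCount_of_not_late (h : ¬ Late n B t) : hubCount n B t = B := if_neg h

theorem hubCount_of_late (h : Late n B t) : hubCount n B t = B + 1 := if_pos h

theorem le_hubCount : B ≤ hubCount n B t := by
  unfold hubCount; split_ifs <;> omega

theorem Valid.hubCount_lt (h : Valid n B t) : hubCount n B t < 2 ^ n := by
  unfold hubCount
  split_ifs with hl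
  · exact succ_lt h.lt (h.low_lt_of_late hl)
  · exact h.lt

theorem entryTrunc_le_hubCount (m : ℕ) : entryTrunc n B t m ≤ hubCount n B t := by
  by_cases hc : m = low n B ∧ Late n B t
  · obtain ⟨rfl, hl⟩ := hc
    rw [entryTrunc_low hl, hubCount_of_late hl]
  · rw [entryTrunc_of_ne hc]
    exact (trunc_le B m).trans le_hubCount

theorem Valid.le_two_mul (h : Valid n B t) : t ≤ 2 * n + 1 := by
  have h1 := h.le
  have h2 := h.le_of_top
  have h3 := low_le n B
  omega

/-- A bit that is still open has a lane position within its range. -/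
theorem Valid.le_of_not_bitSet (h : Valid n B t) {k : ℕ} (hs : ¬ BitSet n B t k) :
    low n B ≤ k ∧ t ≤ 2 * k + 1 := by
  simp only [BitSet, not_or] at hs
  have h1 : low n B ≤ k := by
    by_contra hlt
    exact hs.1 (testBit_of_lt_low (n := n) (by omega))
  have h2 := h.le
  refine ⟨h1, ?_⟩
  rcases h1.eq_or_lt with he | hlt
  · by_contra
    exact hs.2 ⟨he.symm, by omega⟩
  · omega

theorem viaMajor_hub_of_set (h : Valid n B t) {m : ℕ} (hm : m < n) (hs : BitSet n B t m) :
    viaMajor B t (.hub : Node n r) (.jump m) = 2 ^ n - 1 - (trunc B (m + 1) + 2 ^ m) := by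
  simp only [viaMajor, major, dest, ofBit_of_lt hm, distMajor, if_pos hs]
  have h1 := trunc_add_le h.lt (k := m + 1) hm
  have h2 := Nat.two_pow_pos m
  omega

theorem viaMinor_hub_of_set {m : ℕ} (hm : m < n) (hs : BitSet n B t m) :
    viaMinor B t (.hub : Node n r) (.jump m) = 2 * n + 1 := by
  simp only [viaMinor, minor, dest, ofBit_of_lt hm, distMinor, if_pos hs, if_pos hm]
  omega

theorem viaMajor_hub_of_not_set {m : ℕ} (hm : m < n) (hs : ¬ BitSet n B t m) :
    viaMajor B t (.hub : Node n r) (.jump m) = 2 ^ m - 1 + (2 ^ n - 1 - B) := by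
  simp only [viaMajor, major, dest, ofBit_of_lt hm, distMajor, if_neg hs]

theorem viaMinor_hub_of_not_set {m : ℕ} (hm : m < n) (hs : ¬ BitSet n B t m) :
    viaMinor B t (.hub : Node n r) (.jump m) = 2 * m + 2 + (6 * n + 3 - t) := by
  simp only [viaMinor, minor, dest, ofBit_of_lt hm, distMinor, if_neg hs, if_pos hm]

theorem via_hub_top : viaMajor B t (.hub : Node n r) (.jump n) = 2 ^ n - 1 ∧
    viaMinor B t (.hub : Node n r) (.jump n) = 2 * n + 1 := by
  simp [viaMajor, viaMinor, major, minor, dest, Node.ofBit, distMajor, distMinor]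

theorem viaMajor_lane_jump (h : Valid n B t) {m : ℕ} (hm : m ≤ n) (l : Fin (2 * n + 1)) :
    viaMajor B t (.lane l : Node n r) (.jump m) = 2 ^ n - 1 - entryTrunc n B t m := by
  simp only [viaMajor, major, dest, h.distMajor_entry hm]
  have h1 := h.entryTrunc_add_le hm
  have h2 := Nat.two_pow_pos m
  omega

theorem viaMajor_high_jump (h : Valid n B t) {k : Fin n} {m : ℕ} (hkm : k.val ≤ m) (hm : m ≤ n) :
    viaMajor B t (.high k : Node n r) (.jump m) = 2 ^ n - 2 ^ k.val - entryTrunc n B t m := by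
  simp only [viaMajor, major, dest, h.distMajor_entry hm]
  have h1 := h.entryTrunc_add_le hm
  have h2 := Nat.two_pow_pos k.val
  have h3 : 2 ^ k.val ≤ 2 ^ m := Nat.pow_le_pow_right (by norm_num) hkm
  omega

theorem viaMajor_bit_jump (h : Valid n B t) {k : Fin n} {m : ℕ} (hkm : k.val < m) (hm : m ≤ n) :
    viaMajor B t (.bit k : Node n r) (.jump m) =
      2 ^ n - 2 ^ (k.val + 1) - entryTrunc n B t m := by
  simp only [viaMajor, major, dest, h.distMajor_entry hm]
  have h1 := h.entryTrunc_add_le hm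
  have h2 := Nat.two_pow_pos k.val
  have h3 : 2 ^ (k.val + 1) ≤ 2 ^ m := Nat.pow_le_pow_right (by norm_num) hkm
  omega

theorem viaMajor_toHub (s : Node n r) :
    viaMajor B t s .toHub = 2 ^ n - 1 - hubCount n B t := by
  cases s <;> simp [viaMajor, major, dest, distMajor]

theorem viaMinor_lane_toHub (l : Fin (2 * n + 1)) :
    viaMinor B t (.lane l : Node n r) .toHub = 10 * n + 9 := by
  simp only [viaMinor, minor, dest, distMinor]; omega

theorem viaMinor_bit_toHub (k : Fin n) :
    viaMinor B t (.bit k : Node n r) .toHub = 6 * n + 3 := by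
  simp only [viaMinor, minor, dest, distMinor]; omega

theorem viaMajor_toLane (s : Node n r) {l : ℕ} (hl : l ≤ 2 * n) :
    viaMajor B t s (.toLane l) = if l ≤ t then 2 ^ n - 1 - B else 2 ^ n - 1 - hubCount n B t := by
  have h : l < 2 * n + 1 := by omega
  cases s <;> simp [viaMajor, major, dest, ofLane_of_le h, distMajor]

theorem viaMinor_lane_toLane (l' : Fin (2 * n + 1)) {l : ℕ} (hl : l ≤ 2 * n) :
    viaMinor B t (.lane l' : Node n r) (.toLane l) =
      1 + if l ≤ t then 2 * n + 1 + l else 10 * n + 9 := by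
  have h : l < 2 * n + 1 := by omega
  simp [viaMinor, minor, dest, ofLane_of_le h, distMinor]

theorem viaMinor_bit_toLane (k : Fin n) {l : ℕ} (hl : l ≤ 2 * n) :
    viaMinor B t (.bit k : Node n r) (.toLane l) =
      (4 * n + 1 - 2 * l) + if l ≤ t then 2 * n + 1 + l else 10 * n + 9 := by
  have h : l < 2 * n + 1 := by omega
  simp [viaMinor, minor, dest, ofLane_of_le h, distMinor]

theorem viaMajor_take (k : Fin n) :
    viaMajor B t (.high k : Node n r) .take = distMajor B t (.bit k : Node n r) := by
  simp [viaMajor, major, dest]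

theorem viaMinor_take (k : Fin n) :
    viaMinor B t (.high k : Node n r) .take = 1 + distMinor B t (.bit k : Node n r) := by
  simp [viaMinor, minor, dest]

theorem viaMinor_high_jump (k : Fin n) (m : ℕ) : viaMinor B t (.high k : Node n r) (.jump m) =
    2 * (m - k) + 1 + distMinor B t (Node.entry m : Node n r) := rfl

theorem viaMinor_bit_jump (k : Fin n) (m : ℕ) : viaMinor B t (.bit k : Node n r) (.jump m) =
    2 * (m - k - 1) + 1 + distMinor B t (Node.entry m : Node n r) := rfl

theorem viaMinor_lane_jump (l : Fin (2 * n + 1)) (m : ℕ) :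
    viaMinor B t (.lane l : Node n r) (.jump m) =
      2 * m + 1 + distMinor B t (Node.entry m : Node n r) := rfl

/-- The lower-order part through any closed bit is `2 * n + 1`, as it is for the direct jump to the
target, so only the leading parts matter. In the late phase the bit used is `low n B`, otherwise the
lowest set bit. -/
theorem Valid.hub_eq (h : Valid n B t) : ∃ m ≤ n,
    pol B t (.hub : Node n r) = .jump m ∧
    distMajor B t (.hub : Node n r) = viaMajor B t (.hub : Node n r) (.jump m) ∧
    distMinor B t (.hub : Node n r) = viaMinor B t (.hub : Node n r) (.jump m) := by
  by_cases hl : Late n B t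
  · have h1 := h.low_lt_of_late hl
    have h2 : BitSet n B t (low n B) := .of_entrySet (.inr ⟨rfl, hl⟩)
    refine ⟨low n B, h1.le, ?_, ?_, ?_⟩
    · simp [pol, hubCount_of_late hl, nextSet_succ_of_le_low h1]
    · rw [viaMajor_hub_of_set h h1 h2]
      simp only [distMajor, hubCount_of_late hl, ← succ_eq h1]
    · rw [viaMinor_hub_of_set h1 h2]
      rfl
  · have h0 := trunc_eq_of_le_nextSet (le_nextSet n B 0) le_rfl
    rw [trunc_zero] at h0
    refine ⟨nextSet n B 0, nextSet_le_top (Nat.zero_le n), ?_, ?_⟩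
    · simp [pol, hubCount_of_not_late hl]
    · rcases (nextSet_le_top (n := n) (B := B) (Nat.zero_le n)).lt_or_eq with h1 | h1
      · have h2 := testBit_nextSet h1
        rw [viaMajor_hub_of_set h h1 (.inl h2), viaMinor_hub_of_set h1 (.inl h2)]
        refine ⟨?_, rfl⟩
        simp only [distMajor, hubCount_of_not_late hl]
        have h3 := trunc_succ B (nextSet n B 0)
        rw [if_pos h2, h0] at h3
        rw [← h3]
      · rw [h1, via_hub_top.1, via_hub_top.2]
        rw [h1, trunc_top h.lt] at h0
        refine ⟨?_, rfl⟩
        simp only [distMajor]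
        rw [hubCount_of_not_late hl, ← h0, Nat.sub_zero]

theorem isDist_pol (h : Valid n B t) : (graph n r).IsDist (pol B t) (dist B t) := by
  have key : ∀ s : Node n r, (act s).Nonempty → pol B t s ∈ act s ∧
      distMajor B t s = viaMajor B t s (pol B t s) ∧
      distMinor B t s = viaMinor B t s (pol B t s) := by
    intro s hs
    match s with
    | .target => simp [act] at hs
    | .pad _ => simp [act] at hs
    | .hub =>
      obtain ⟨m, hm, h1, h2, h3⟩ := h.hub_eq (r := r)
      rw [h1]
      exact ⟨mem_act_hub.2 ⟨m, hm, rfl⟩, h2, h3⟩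
    | .lane l =>
      have hlt := l.2
      by_cases hl : l.val = 0
      · have h1 := nextSet_le_top (n := n) (B := B) (Nat.zero_le n)
        have hp : pol B t (.lane l : Node n r) = .jump (nextSet n B 0) := by simp [pol, hl]
        rw [hp, mem_act_lane_zero hl, viaMajor_lane_jump h h1, h.entryTrunc_nextSet, trunc_zero,
          viaMinor_lane_jump, distMinor_entry_nextSet (Nat.zero_le n)]
        refine ⟨⟨_, h1, rfl⟩, ?_, ?_⟩
        · simp [distMajor, hl]
        · simp only [distMinor, hl, Nat.zero_le, if_true]; omega
      · by_cases hlt' : l.val ≤ t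
        · have hp : pol B t (.lane l : Node n r) = .toLane (l - 1) := by simp [pol, hl, hlt']
          rw [hp, mem_act_lane hl, viaMajor_toLane _ (by omega), viaMinor_lane_toLane _ (by omega)]
          rw [if_pos (by omega), if_pos (by omega)]
          refine ⟨.inr rfl, ?_, ?_⟩
          · simp only [distMajor, if_pos hlt']
          · simp only [distMinor, if_pos hlt']; omega
        · have hp : pol B t (.lane l : Node n r) = .toHub := by simp [pol, hl, hlt']
          rw [hp, mem_act_lane hl, viaMajor_toHub, viaMinor_lane_toHub]
          simp only [distMajor, distMinor, if_neg hlt']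
          simp
    | .high k =>
      have hlt : k.val + 1 ≤ n := k.2
      by_cases hk : EntrySet n B t k
      · have hp : pol B t (.high k : Node n r) = .take := if_pos hk
        have hb := BitSet.of_entrySet hk
        rw [hp, viaMajor_take, viaMinor_take]
        simp only [distMajor, distMinor, if_pos hk, if_pos hb, h.entryTrunc_of_set hk]
        refine ⟨mem_act_high.2 (.inl rfl), ?_, by omega⟩
        rw [pow_succ]; omega
      · have h1 := nextSet_le_top (n := n) (B := B) (k := k + 1) hlt
        have h2 := le_nextSet n B (k + 1)
        have hp : pol B t (.high k : Node n r) = .jump (nextSet n B (k + 1)) := if_neg hk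
        rw [hp, viaMajor_high_jump h (by omega) h1, viaMinor_high_jump, h.entryTrunc_nextSet,
          distMinor_entry_nextSet hlt]
        simp only [distMajor, distMinor, if_neg hk, entryTrunc_of_not_set hk]
        exact ⟨mem_act_high.2 (.inr ⟨_, ⟨h2, h1⟩, rfl⟩), trivial, by omega⟩
    | .bit k =>
      have hlt : k.val + 1 ≤ n := k.2
      by_cases hk : BitSet n B t k
      · have h1 := nextSet_le_top (n := n) (B := B) (k := k + 1) hlt
        have h2 := le_nextSet n B (k + 1)
        have hp : pol B t (.bit k : Node n r) = .jump (nextSet n B (k + 1)) := if_pos hk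
        rw [hp, viaMajor_bit_jump h (by omega) h1, viaMinor_bit_jump, h.entryTrunc_nextSet,
          distMinor_entry_nextSet hlt]
        simp only [distMajor, distMinor, if_pos hk]
        exact ⟨mem_act_bit.2 (.inr (.inr ⟨_, ⟨h2, h1⟩, rfl⟩)), trivial, by omega⟩
      · obtain ⟨h1, h2⟩ := h.le_of_not_bitSet hk
        by_cases ht : t = 0
        · have hp : pol B t (.bit k : Node n r) = .toHub := by
            simp only [pol, if_neg hk, if_pos ht]
          rw [hp, viaMajor_toHub, viaMinor_bit_toHub,
            hubCount_of_not_late (by simp only [Late]; omega)]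
          simp only [distMajor, distMinor, if_neg hk]
          exact ⟨mem_act_bit.2 (.inl rfl), trivial, by omega⟩
        · have hp : pol B t (.bit k : Node n r) = .toLane (t - 1) := by
            simp only [pol, if_neg hk, if_neg ht]
          rw [hp, viaMajor_toLane _ (by omega), viaMinor_bit_toLane _ (by omega),
            if_pos (by omega), if_pos (by omega)]
          simp only [distMajor, distMinor, if_neg hk]
          exact ⟨mem_act_bit.2 (.inr (.inl ⟨_, by omega, rfl⟩)), trivial, by omega⟩
  refine ⟨fun s hs => (key s hs).1, by simp [graph, dist, distMajor, distMinor], fun s hs => ?_⟩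
  rw [cost_add_dist, dist, (key s hs).2.1, (key s hs).2.2]

end BinaryCounter

/-! ### The greedy choice at each kind of node -/

namespace BinaryCounter

variable {n r B t : ℕ} {π' : Node n r → Act}

/-- Phase `2 * low n B + 2` is the only one in which a bit is closed that the hub has not yet taken
into account. Open bits never attract the hub, since they lead back to it or to a lane no better in
the leading part. -/
theorem keep_hub (h : Valid n B t) (ht : t ≠ 2 * low n B + 2)
    (hstep : (graph n r).toMDP.GreedyStep (pol B t) π') : π' .hub = pol B t (.hub : Node n r) := by
  refine step_keep (isDist_pol h) hstep fun a ha => ?_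
  obtain ⟨m, hm, rfl⟩ := mem_act_hub.1 ha
  have hB := h.lt
  have hhub := le_hubCount (n := n) (B := B) (t := t)
  have ht' := h.le_two_mul
  rcases hm.lt_or_eq with hm | rfl
  · by_cases hs : BitSet n B t m
    · rw [viaMajor_hub_of_set h hm hs, viaMinor_hub_of_set hm hs]
      have hs' : EntrySet n B t m := hs.imp_right fun hs =>
        ⟨hs.1, by have := h.le; simp only [Late]; omega⟩
      have h1 := entryTrunc_le_hubCount (n := n) (B := B) (t := t) m
      rw [h.entryTrunc_of_set hs'] at h1
      simp only [distMajor, distMinor]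
      omega
    · rw [viaMajor_hub_of_not_set hm hs, viaMinor_hub_of_not_set hm hs]
      simp only [distMajor, distMinor]
      omega
  · rw [via_hub_top.1, via_hub_top.2]
    simp only [distMajor, distMinor]
    omega

theorem hub_switch (h : Valid n B t) (hlow : low n B < n) (ht : t = 2 * low n B + 2)
    (hstep : (graph n r).toMDP.GreedyStep (pol B t) π') : π' .hub = .jump (low n B) := by
  have hl : ¬ Late n B t := by simp only [Late]; omega
  have hs0 : BitSet n B t (low n B) := .inr ⟨rfl, ht.ge⟩
  have hB := succ_lt h.lt hlow
  have hi := succ_eq hlow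
  refine step_fast (isDist_pol h) hstep (mem_act_hub.2 ⟨_, hlow.le, rfl⟩) rfl ?_ fun a ha hne => ?_
  · rw [viaMajor_hub_of_set h hlow hs0, ← hi]
    simp only [distMajor, hubCount_of_not_late hl]
    omega
  · obtain ⟨m, hm, rfl⟩ := mem_act_hub.1 ha
    have hne' : m ≠ low n B := fun he => hne (he ▸ rfl)
    refine .inr ⟨rfl, .inl ?_⟩
    rw [viaMajor_hub_of_set h hlow hs0, ← hi]
    rcases hm.lt_or_eq with hm | rfl
    · by_cases hs : BitSet n B t m
      · rw [viaMajor_hub_of_set h hm hs]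
        have h1 := trunc_succ B m
        rw [if_pos (hs.resolve_right fun hc => hne' hc.1)] at h1
        have h2 := trunc_le B m
        omega
      · rw [viaMajor_hub_of_not_set hm hs]
        omega
    · rw [via_hub_top.1]
      omega

theorem keep_lane_zero (h : Valid n B t) (hl : ¬ Late n B t) {l : Fin (2 * n + 1)}
    (hl0 : l.val = 0) (hstep : (graph n r).toMDP.GreedyStep (pol B t) π') :
    π' (.lane l) = pol B t (.lane l : Node n r) := by
  refine step_keep (isDist_pol h) hstep fun a ha => ?_
  obtain ⟨m, hm, rfl⟩ := (mem_act_lane_zero hl0).1 ha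
  rw [viaMajor_lane_jump h hm, viaMinor_lane_jump]
  have h1 := entryTrunc_le_hubCount (n := n) (B := B) (t := t) m
  rw [hubCount_of_not_late hl] at h1
  have h2 := le_distMinor_entry (n := n) (r := r) (B := B) (t := t) m
  generalize distMinor B t (Node.entry m : Node n r) = x at *
  simp only [distMajor, distMinor, hl0, Nat.zero_le, if_true]
  omega

theorem lane_zero_switch (h : Valid n B t) (hl : Late n B t) {l : Fin (2 * n + 1)}
    (hl0 : l.val = 0) (hstep : (graph n r).toMDP.GreedyStep (pol B t) π') :
    π' (.lane l) = .jump (low n B) := by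
  have hlow := h.low_lt_of_late hl
  have hB := succ_lt h.lt hlow
  refine step_fast (isDist_pol h) hstep ((mem_act_lane_zero hl0).2 ⟨_, hlow.le, rfl⟩) rfl ?_
    fun a ha hne => ?_
  · rw [viaMajor_lane_jump h hlow.le, entryTrunc_low hl]
    simp only [distMajor, hl0, Nat.zero_le, if_true]
    omega
  · obtain ⟨m, hm, rfl⟩ := (mem_act_lane_zero hl0).1 ha
    have hne' : m ≠ low n B := fun he => hne (he ▸ rfl)
    refine .inr ⟨rfl, .inl ?_⟩
    rw [viaMajor_lane_jump h hlow.le, viaMajor_lane_jump h hm, entryTrunc_low hl,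
      entryTrunc_of_ne fun hc => hne' hc.1]
    have := trunc_le B m
    omega

theorem keep_lane (h : Valid n B t) {l : Fin (2 * n + 1)} (hl0 : l.val ≠ 0)
    (hc : (l.val ≤ t ∧ ¬ Late n B t) ∨ t < l.val ∧ (l.val ≠ t + 1 ∨ Late n B t))
    (hstep : (graph n r).toMDP.GreedyStep (pol B t) π') :
    π' (.lane l) = pol B t (.lane l : Node n r) := by
  refine step_keep (isDist_pol h) hstep fun a ha => ?_
  have hlt := l.2
  have hB := h.hubCount_lt
  rcases (mem_act_lane hl0).1 ha with rfl | rfl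
  · rw [viaMajor_toHub, viaMinor_lane_toHub]
    rcases hc with ⟨h1, h2⟩ | ⟨h1, h2⟩
    · simp only [distMajor, distMinor, true_and, if_pos h1, hubCount_of_not_late h2]
      omega
    · simp only [distMajor, distMinor, true_and, if_neg h1.not_ge]
      omega
  · rw [viaMajor_toLane _ (by omega), viaMinor_lane_toLane _ (by omega)]
    rcases hc with ⟨h1, h2⟩ | ⟨h1, h2⟩
    · simp only [distMajor, distMinor, true_and, if_pos h1, if_pos (show l.val - 1 ≤ t by omega)]
      omega
    · simp only [distMajor, distMinor, if_neg h1.not_ge]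
      by_cases hlt' : l.val - 1 ≤ t
      · have h3 := hubCount_of_late (h2.resolve_left (by omega))
        simp only [if_pos hlt']
        omega
      · simp only [if_neg hlt', true_and]
        omega

/-- The leading parts agree, and the lane route replaces the expensive lower-order part `10 * n + 9`
of the route through the hub. -/
theorem lane_advance (h : Valid n B t) (hl : ¬ Late n B t) {l : Fin (2 * n + 1)}
    (hlt : l.val = t + 1) (hstep : (graph n r).toMDP.GreedyStep (pol B t) π') :
    π' (.lane l) = .toLane (l - 1) := by
  have hlt' := l.2
  have hl0 : l.val ≠ 0 := by omega
  have hv1 := viaMajor_toLane (B := B) (t := t) (.lane l : Node n r) (l := l - 1) (by omega)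
  have hv2 := viaMinor_lane_toLane (B := B) (t := t) (r := r) l (l := l - 1) (by omega)
  rw [if_pos (by omega)] at hv1 hv2
  refine step_fast (isDist_pol h) hstep ((mem_act_lane hl0).2 (.inr rfl)) rfl ?_
    fun a ha hne => ?_
  · rw [hv1, hv2]
    simp only [distMajor, distMinor]
    rw [if_neg (by omega), if_neg (by omega), hubCount_of_not_late hl]
    omega
  · rcases (mem_act_lane hl0).1 ha with rfl | rfl
    · rw [hv1, hv2, viaMajor_toHub, viaMinor_lane_toHub, hubCount_of_not_late hl]
      exact .inr ⟨rfl, by omega⟩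
    · exact absurd rfl hne

theorem lane_reset (h : Valid n B t) (hl : Late n B t) {l : Fin (2 * n + 1)}
    (hl0 : l.val ≠ 0) (hlt : l.val ≤ t) (hstep : (graph n r).toMDP.GreedyStep (pol B t) π') :
    π' (.lane l) = .toHub := by
  have hlt' := l.2
  have hB := succ_lt h.lt (h.low_lt_of_late hl)
  refine step_fast (isDist_pol h) hstep ((mem_act_lane hl0).2 (.inl rfl)) rfl ?_
    fun a ha hne => ?_
  · rw [viaMajor_toHub, hubCount_of_late hl]
    simp only [distMajor]
    rw [if_pos hlt]
    omega
  · rcases (mem_act_lane hl0).1 ha with rfl | rfl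
    · exact absurd rfl hne
    · rw [viaMajor_toHub, viaMajor_toLane _ (by omega), if_pos (by omega), hubCount_of_late hl]
      exact .inr ⟨rfl, by omega⟩

theorem keep_high (h : Valid n B t) {k : Fin n} (hk : low n B ≤ k ∨ ¬ Late n B t)
    (hc : EntrySet n B t k ∨ ¬ BitSet n B t k)
    (hstep : (graph n r).toMDP.GreedyStep (pol B t) π') :
    π' (.high k) = pol B t (.high k : Node n r) := by
  refine step_keep (isDist_pol h) hstep fun a ha => ?_
  have hkn := k.2
  have hp := Nat.two_pow_pos k.val
  have hb := trunc_add_le h.lt (k := k.val + 1) hkn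
  have ht := h.le_two_mul
  have hB := h.lt
  rcases mem_act_high.1 ha with rfl | ⟨m, ⟨hkm, hm⟩, rfl⟩
  · rw [viaMajor_take, viaMinor_take]
    simp only [distMajor, distMinor]
    rcases hc with hs | hs
    · rw [if_pos hs, if_pos (.of_entrySet hs), if_pos (.of_entrySet hs), h.entryTrunc_of_set hs]
      rw [pow_succ] at *
      omega
    · have hs' : ¬ EntrySet n B t k := fun hc => hs (.of_entrySet hc)
      rw [if_neg hs', if_neg hs, if_neg hs, entryTrunc_of_not_set hs']
      -- Taking an open bit has leading length `2 ^ n - 1 - B`, no shorter than skipping it, since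
      -- the bits of `B` below `k` amount to less than `2 ^ k`; a tie is settled by the lower-order
      -- part.
      have h1 := lt_trunc_add B k
      have h2 := trunc_succ B k
      rw [if_neg fun hc => hs (.inl hc)] at h2
      omega
  · rw [viaMajor_high_jump h hkm.le hm, viaMinor_high_jump, entryTrunc_of_ne fun hc => by
      obtain ⟨rfl, hl⟩ := hc
      exact hk.elim (fun hk => by omega) fun hk => hk hl]
    have h1 := trunc_anti B (show k.val + 1 ≤ m from hkm)
    have h2 := le_distMinor_entry (n := n) (r := r) (B := B) (t := t) m
    generalize distMinor B t (Node.entry m : Node n r) = x at *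
    simp only [distMajor, distMinor]
    by_cases hs : EntrySet n B t k
    · rw [if_pos hs, h.entryTrunc_of_set hs]
      omega
    · rw [if_neg hs, entryTrunc_of_not_set hs]
      omega

/-- Passing through the newly closed bit saves `2 ^ k` over every jump that skips it. -/
theorem high_switch (h : Valid n B t) (ht : t = 2 * low n B + 2) {k : Fin n}
    (hk : k.val = low n B) (hstep : (graph n r).toMDP.GreedyStep (pol B t) π') :
    π' (.high k) = .take := by
  have hkn := k.2
  have hl : ¬ Late n B t := by simp only [Late]; omega
  have hs : BitSet n B t k := .inr ⟨hk, ht.ge⟩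
  have hs' : ¬ EntrySet n B t k := by
    simp only [EntrySet, not_or]
    exact ⟨by rw [hk, testBit_low (by omega)]; simp, fun hc => hl hc.2⟩
  have hp := Nat.two_pow_pos k.val
  have hb := trunc_add_le h.lt (k := k.val + 1) hkn
  have hv : viaMajor B t (.high k : Node n r) .take =
      2 ^ n - 2 ^ (k.val + 1) - trunc B (k + 1) := by
    rw [viaMajor_take]
    simp only [distMajor, if_pos hs]
  refine step_fast (isDist_pol h) hstep (mem_act_high.2 (.inl rfl)) rfl ?_ fun a ha hne => ?_
  · rw [hv]
    simp only [distMajor, entryTrunc_of_not_set hs']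
    rw [pow_succ] at *
    omega
  · rcases mem_act_high.1 ha with rfl | ⟨m, ⟨hkm, hm⟩, rfl⟩
    · exact absurd rfl hne
    · rw [hv, viaMajor_high_jump h hkm.le hm, entryTrunc_of_ne fun hc => hl hc.2]
      have h1 := trunc_anti B (show k.val + 1 ≤ m from hkm)
      refine .inr ⟨rfl, .inl ?_⟩
      rw [pow_succ] at *
      omega

/-- Jumping to the entry of the new bit realises the count `B + 1`, while every other action
realises at most `B`. -/
theorem high_reset (h : Valid n B t) (hl : Late n B t) {k : Fin n}
    (hk : k.val < low n B) (hstep : (graph n r).toMDP.GreedyStep (pol B t) π') :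
    π' (.high k) = .jump (low n B) := by
  have hlow := h.low_lt_of_late hl
  have hs : EntrySet n B t k := .inl (testBit_of_lt_low hk)
  have ht := h.entryTrunc_add_le hlow.le
  rw [entryTrunc_low hl] at ht
  have hpk : 2 ^ k.val ≤ 2 ^ low n B := Nat.pow_le_pow_right (by norm_num) hk.le
  have hb : entryTrunc n B t k = trunc B k := entryTrunc_of_ne fun hc => by omega
  have hb' := h.entryTrunc_of_set hs
  have hle := trunc_le B k
  refine step_fast (isDist_pol h) hstep (mem_act_high.2 (.inr ⟨_, ⟨hk, hlow.le⟩, rfl⟩)) rfl ?_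
    fun a ha hne => ?_
  · rw [viaMajor_high_jump h hk.le hlow.le, entryTrunc_low hl]
    simp only [distMajor, hb]
    omega
  · rw [viaMajor_high_jump h hk.le hlow.le, entryTrunc_low hl]
    rcases mem_act_high.1 ha with rfl | ⟨m, ⟨hkm, hm⟩, rfl⟩
    · rw [viaMajor_take]
      simp only [distMajor, if_pos (BitSet.of_entrySet hs)]
      refine .inr ⟨rfl, .inl ?_⟩
      rw [pow_succ]
      omega
    · have hne' : m ≠ low n B := fun he => hne (he ▸ rfl)
      rw [viaMajor_high_jump h hkm.le hm, entryTrunc_of_ne fun hc => hne' hc.1]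
      have := trunc_le B m
      exact .inr ⟨rfl, by omega⟩

theorem keep_bit (h : Valid n B t) {k : Fin n} (hs : BitSet n B t k)
    (hk : low n B ≤ k ∨ ¬ Late n B t)
    (hstep : (graph n r).toMDP.GreedyStep (pol B t) π') :
    π' (.bit k) = pol B t (.bit k : Node n r) := by
  have hkn := k.2
  have hb := trunc_add_le h.lt (k := k.val + 1) hkn
  have hB := h.hubCount_lt
  have hBle := le_hubCount (n := n) (B := B) (t := t)
  have hp := Nat.two_pow_pos (k.val + 1)
  -- The hub beats a closed bit `k` only if its count reaches the next multiple of `2 ^ (k + 1)`. An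
  -- increment changes no bit above `low n B`, so this does not happen here.
  have hhub : hubCount n B t < trunc B (k + 1) + 2 ^ (k.val + 1) := by
    by_cases hl : Late n B t
    · rw [hubCount_of_late hl, ← trunc_succ_of_low_lt (h.low_lt_of_late hl) (by omega)]
      exact lt_trunc_add _ _
    · rw [hubCount_of_not_late hl]
      exact lt_trunc_add _ _
  refine step_keep (isDist_pol h) hstep fun a ha => ?_
  simp only [distMajor, distMinor, if_pos hs]
  rcases mem_act_bit.1 ha with rfl | ⟨l, hl, rfl⟩ | ⟨m, ⟨hkm, hm⟩, rfl⟩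
  · rw [viaMajor_toHub, viaMinor_bit_toHub]
    omega
  · rw [viaMajor_toLane _ (by omega), viaMinor_bit_toLane _ (by omega)]
    split_ifs <;> omega
  · rw [viaMajor_bit_jump h hkm hm, viaMinor_bit_jump, entryTrunc_of_ne fun hc => by
      obtain ⟨rfl, hl⟩ := hc
      exact hk.elim (fun hk => by omega) fun hk => hk hl]
    have h1 := trunc_anti B (show k.val + 1 ≤ m from hkm)
    have h2 := le_distMinor_entry (n := n) (r := r) (B := B) (t := t) m
    omega

/-- The lower-order part drops from `6 * n + 3 - t` to `6 * n + 2 - t`. This gain of one on a fast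
edge outweighs anything a slow closing edge offers. Lanes below `t` gain less, and those above `t`
still pay for the route through the hub. -/
theorem bit_advance (h : Valid n B t) (hl : ¬ Late n B t) {k : Fin n} (hs : ¬ BitSet n B t k)
    (ht : t ≤ 2 * k.val) (hstep : (graph n r).toMDP.GreedyStep (pol B t) π') :
    π' (.bit k) = .toLane t := by
  have hkn := k.2
  have hv1 := viaMajor_toLane (B := B) (t := t) (.bit k : Node n r) (l := t) (by omega)
  have hv2 := viaMinor_bit_toLane (B := B) (t := t) (r := r) k (l := t) (by omega)
  rw [if_pos le_rfl] at hv1 hv2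
  refine step_fast (isDist_pol h) hstep (mem_act_bit.2 (.inr (.inl ⟨_, ht, rfl⟩))) rfl ?_
    fun a ha hne => ?_
  · rw [hv1, hv2]
    simp only [distMajor, distMinor, true_and, if_neg hs]
    omega
  · rw [hv1, hv2]
    rcases mem_act_bit.1 ha with rfl | ⟨l, hl', rfl⟩ | ⟨m, ⟨hkm, hm⟩, rfl⟩
    · rw [viaMajor_toHub, viaMinor_bit_toHub, hubCount_of_not_late hl]
      exact .inr ⟨rfl, by omega⟩
    · rw [viaMajor_toLane _ (by omega), viaMinor_bit_toLane _ (by omega), hubCount_of_not_late hl]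
      have hne' : l ≠ t := fun he => hne (he ▸ rfl)
      refine .inr ⟨rfl, .inr ?_⟩
      split_ifs <;> omega
    · exact .inl rfl

/-- The bit already uses its last lane `2 * k`, so no fast edge improves. Closing gains `2 ^ k` in
the leading part. -/
theorem bit_close (h : Valid n B t) {k : Fin n} (hk : k.val = low n B)
    (ht : t = 2 * low n B + 1) (hstep : (graph n r).toMDP.GreedyStep (pol B t) π') :
    π' (.bit k) = .jump (nextSet n B (k + 1)) := by
  have hkn : k.val + 1 ≤ n := k.2
  have hl : ¬ Late n B t := by simp only [Late]; omega
  have hs : ¬ BitSet n B t k := by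
    simp only [BitSet, not_or]
    refine ⟨by rw [hk, testBit_low (by omega)]; simp, by omega⟩
  have h1 := nextSet_le_top (n := n) (B := B) hkn
  have h2 := le_nextSet n B (k + 1)
  have hp := Nat.two_pow_pos k.val
  have hb := trunc_add_le h.lt (k := k.val + 1) hkn
  have hB := succ_eq (n := n) (B := B) (by omega)
  have hv1 := viaMajor_bit_jump (r := r) h (k := k) (by omega) h1
  have hv2 := viaMinor_bit_jump (r := r) (B := B) (t := t) k (nextSet n B (k + 1))
  rw [h.entryTrunc_nextSet] at hv1
  rw [distMinor_entry_nextSet hkn] at hv2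
  refine step_slow (isDist_pol h) hstep (mem_act_bit.2 (.inr (.inr ⟨_, ⟨h2, h1⟩, rfl⟩))) rfl ?_
    fun a ha hne => ?_
  · rw [hv1]
    simp only [distMajor, if_neg hs]
    rw [← hk] at hB
    rw [pow_succ] at *
    omega
  · rcases mem_act_bit.1 ha with rfl | ⟨l, hl', rfl⟩ | ⟨m, ⟨hkm, hm⟩, rfl⟩
    · rw [viaMajor_toHub, viaMinor_bit_toHub, hubCount_of_not_late hl]
      simp only [distMajor, distMinor, true_and, if_neg hs]
      omega
    · rw [viaMajor_toLane _ (by omega), viaMinor_bit_toLane _ (by omega), hubCount_of_not_late hl]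
      simp only [distMajor, distMinor, if_neg hs]
      rw [if_pos (by omega), if_pos (by omega)]
      omega
    · refine .inr ⟨rfl, ?_⟩
      have hne' : m ≠ nextSet n B (k + 1) := fun he => hne (he ▸ rfl)
      rw [hv1, hv2, viaMajor_bit_jump h hkm hm, viaMinor_bit_jump,
        entryTrunc_of_ne fun hc => hl hc.2]
      -- Overshooting the next set bit costs in the leading part; stopping at an unset bit before it
      -- costs one in the lower-order part. Hence the best jump is unique.
      rcases ne_nextSet (show k.val + 1 ≤ m from hkm) hm hne' hkn with hlt | ⟨heq, hmn, hbit⟩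
      · omega
      · rw [heq, distMinor_entry_of_not_set hmn (by simp [EntrySet, hbit, hl])]
        omega

/-- A bit below `low n B` has leading length `2 ^ n - (B + 1)`, and an open bit still has `2 ^ n - 1
- B`; the hub, already counting `B + 1`, is shorter by one than either. -/
theorem bit_reset (h : Valid n B t) (hl : Late n B t) {k : Fin n}
    (hk : k.val < low n B ∨ ¬ BitSet n B t k)
    (hstep : (graph n r).toMDP.GreedyStep (pol B t) π') : π' (.bit k) = .toHub := by
  have hkn := k.2
  have hB := succ_lt h.lt (h.low_lt_of_late hl)
  have hl' := hl
  simp only [Late] at hl'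
  refine step_fast (isDist_pol h) hstep (mem_act_bit.2 (.inl rfl)) rfl ?_
    fun a ha hne => ?_
  · rw [viaMajor_toHub, hubCount_of_late hl]
    rcases hk with hk | hk
    · have hs : BitSet n B t k := .inl (testBit_of_lt_low hk)
      have h1 := trunc_of_le_low (show k.val + 1 ≤ low n B from hk)
      simp only [distMajor, if_pos hs]
      omega
    · simp only [distMajor, if_neg hk]
      omega
  · rcases mem_act_bit.1 ha with rfl | ⟨l, hlk, rfl⟩ | ⟨m, ⟨hkm, hm⟩, rfl⟩
    · exact absurd rfl hne
    · refine .inr ⟨rfl, ?_⟩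
      rw [viaMajor_toHub, viaMinor_bit_toHub, viaMajor_toLane _ (by omega),
        viaMinor_bit_toLane _ (by omega), hubCount_of_late hl]
      split_ifs <;> omega
    · exact .inl rfl

end BinaryCounter

/-! ### The run of the counter -/

namespace BinaryCounter

variable {n r B t : ℕ} {π' : Node n r → Act}

theorem Valid.succ_phase (h : Valid n B t) (hl : ¬ Late n B t) (ht : low n B = n → t < 2 * n) :
    Valid n B (t + 1) where
  lt := h.lt
  le := by have := h.le; simp only [Late] at hl; omega
  le_of_top := ht

theorem Valid.succ_count (h : Valid n B t) (hl : Late n B t) : Valid n (B + 1) 0 where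
  lt := succ_lt h.lt (h.low_lt_of_late hl)
  le := Nat.zero_le _
  le_of_top _ := Nat.zero_le _

theorem step_within (h : Valid n B t) (hl : ¬ Late n B t) (ht : low n B = n → t < 2 * n)
    (hstep : (graph n r).toMDP.GreedyStep (pol B t) π') : π' = pol B (t + 1) := by
  have hle := h.le
  have hle' := low_le n B
  have hl' := hl
  simp only [Late] at hl'
  funext s
  match s with
  | .target => exact (hstep _).2 fun ⟨a, ha, _⟩ => absurd ha (Finset.notMem_empty a)
  | .pad _ => exact (hstep _).2 fun ⟨a, ha, _⟩ => absurd ha (Finset.notMem_empty a)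
  | .hub =>
    by_cases h2 : t = 2 * low n B + 2
    · have hlow : low n B < n := by
        by_contra hc
        have := ht (by omega)
        omega
      rw [hub_switch h hlow h2 hstep]
      have hlate : Late n B (t + 1) := by simp only [Late]; omega
      simp only [pol, hubCount_of_late hlate, nextSet_succ_of_le_low hlow (Nat.zero_le _)]
    · rw [keep_hub h h2 hstep]
      have hlate : ¬ Late n B (t + 1) := by simp only [Late]; omega
      simp only [pol, hubCount_of_not_late hlate, hubCount_of_not_late hl]
  | .lane l =>
    by_cases hl0 : l.val = 0
    · rw [keep_lane_zero h hl hl0 hstep]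
      simp only [pol, if_pos hl0]
    · by_cases hlt : l.val = t + 1
      · rw [lane_advance h hl hlt hstep]
        simp only [pol, if_neg hl0, if_pos hlt.le]
      · rw [keep_lane h hl0 (by omega) hstep]
        simp only [pol, if_neg hl0]
        by_cases hlt' : l.val ≤ t
        · rw [if_pos hlt', if_pos (by omega)]
        · rw [if_neg hlt', if_neg (by omega)]
  | .high k =>
    have hk := k.2
    by_cases hs : k.val = low n B ∧ t = 2 * low n B + 2
    · rw [high_switch h hs.2 hs.1 hstep]
      exact (if_pos (.inr ⟨hs.1, by simp only [Late]; omega⟩)).symm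
    · have h1 : ∀ t', t' = t ∨ t' = t + 1 → (EntrySet n B t' k ↔ B.testBit k = true) := by
        intro t' ht'
        simp only [EntrySet, Late, or_iff_left_iff_imp]
        omega
      rw [keep_high h (.inr hl) ?_ hstep]
      · simp only [pol, h1 t (.inl rfl), h1 (t + 1) (.inr rfl)]
      · by_cases hb : B.testBit k = true
        · exact .inl (.inl hb)
        · refine .inr ?_
          simp only [BitSet, not_or]
          exact ⟨hb, by omega⟩
  | .bit k =>
    by_cases hs : BitSet n B t k
    · rw [keep_bit h hs (.inr hl) hstep]
      have hs' : BitSet n B (t + 1) k := hs.imp_right fun hc => ⟨hc.1, by omega⟩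
      simp only [pol, if_pos hs, if_pos hs']
    · by_cases hc : k.val = low n B ∧ t = 2 * low n B + 1
      · rw [bit_close h hc.1 hc.2 hstep]
        exact (if_pos (.inr ⟨hc.1, by omega⟩)).symm
      · obtain ⟨h1, h2⟩ := h.le_of_not_bitSet hs
        -- Each open bit above `low n B` has at least two more lanes than that bit, enough to stay
        -- distracted until the late phase.
        have hs' : ¬ BitSet n B (t + 1) k := by
          simp only [BitSet, not_or] at hs ⊢
          exact ⟨hs.1, by omega⟩
        rw [bit_advance h hl hs (by omega) hstep]
        simp only [pol, if_neg hs', Nat.succ_ne_zero, if_false, Nat.add_sub_cancel]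

theorem step_increment (h : Valid n B t) (hl : Late n B t)
    (hstep : (graph n r).toMDP.GreedyStep (pol B t) π') : π' = pol (B + 1) 0 := by
  have hlow := h.low_lt_of_late hl
  have hl' := hl
  simp only [Late] at hl'
  have hnl : ¬ Late n (B + 1) 0 := by simp only [Late]; omega
  have hE : ∀ k, EntrySet n (B + 1) 0 k ↔ (B + 1).testBit k = true := fun k => by
    simp only [EntrySet, hnl, and_false, or_false]
  have hS : ∀ k, BitSet n (B + 1) 0 k ↔ (B + 1).testBit k = true := fun k => by
    simp [BitSet]
  funext s
  match s with
  | .target => exact (hstep _).2 fun ⟨a, ha, _⟩ => absurd ha (Finset.notMem_empty a)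
  | .pad _ => exact (hstep _).2 fun ⟨a, ha, _⟩ => absurd ha (Finset.notMem_empty a)
  | .hub =>
    rw [keep_hub h (by omega) hstep]
    simp only [pol, hubCount_of_not_late hnl, hubCount_of_late hl]
  | .lane l =>
    by_cases hl0 : l.val = 0
    · rw [lane_zero_switch h hl hl0 hstep]
      simp only [pol, if_pos hl0, nextSet_succ_of_le_low hlow (Nat.zero_le _)]
    · have hp : pol (B + 1) 0 (.lane l : Node n r) = .toHub := by
        simp only [pol, if_neg hl0, if_neg (show ¬ l.val ≤ 0 by omega)]
      rw [hp]
      by_cases hlt : l.val ≤ t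
      · exact lane_reset h hl hl0 hlt hstep
      · rw [keep_lane h hl0 (.inr ⟨by omega, .inr hl⟩) hstep]
        simp only [pol, if_neg hl0, if_neg hlt]
  | .high k =>
    simp only [pol, hE, testBit_succ hlow]
    rcases lt_trichotomy k.val (low n B) with hk | hk | hk
    · rw [high_reset h hl hk hstep, if_pos hk, nextSet_succ_of_le_low hlow (by omega)]
      simp
    · have hs : EntrySet n B t k := .inr ⟨hk, hl⟩
      rw [keep_high h (.inl hk.ge) (.inl hs) hstep, if_neg hk.not_lt, if_pos hk]
      simp only [pol, if_pos hs, if_true]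
    · have hs : EntrySet n B t k ↔ B.testBit k = true := by
        simp only [EntrySet, or_iff_left_iff_imp]
        omega
      rw [keep_high h (.inl hk.le) ?_ hstep, if_neg hk.not_gt, if_neg hk.ne',
        nextSet_succ_of_low_lt hlow (by omega)]
      · simp only [pol, hs]
      · by_cases hb : B.testBit k = true
        · exact .inl (.inl hb)
        · refine .inr ?_
          simp only [BitSet, not_or]
          exact ⟨hb, by omega⟩
  | .bit k =>
    simp only [pol, hS, testBit_succ hlow]
    rcases lt_trichotomy k.val (low n B) with hk | hk | hk
    · rw [bit_reset h hl (.inl hk) hstep, if_pos hk]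
      simp
    · have hs : BitSet n B t k := .inr ⟨hk, by omega⟩
      rw [keep_bit h hs (.inl hk.ge) hstep, if_neg hk.not_lt, if_pos hk,
        nextSet_succ_of_low_lt hlow (by omega)]
      simp only [pol, if_pos hs, if_true]
    · rw [if_neg hk.not_gt, if_neg hk.ne', nextSet_succ_of_low_lt hlow (by omega)]
      by_cases hb : B.testBit k = true
      · have hs : BitSet n B t k := .inl hb
        rw [keep_bit h hs (.inl hk.le) hstep, if_pos hb]
        simp only [pol, if_pos hs]
      · have hs : ¬ BitSet n B t k := by
          simp only [BitSet, not_or]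
          exact ⟨hb, by omega⟩
        rw [bit_reset h hl (.inr hs) hstep, if_neg hb, if_pos trivial]

theorem step_final (h : Valid n B t) (hlow : low n B = n) (ht : t = 2 * n)
    (hstep : (graph n r).toMDP.GreedyStep (pol B t) π') : π' = pol B t := by
  have hl : ¬ Late n B t := by simp only [Late]; omega
  have hbit : ∀ k : Fin n, B.testBit k = true := fun k =>
    testBit_of_lt_low (hlow.symm ▸ k.2 : k.val < low n B)
  funext s
  match s with
  | .target => exact (hstep _).2 fun ⟨a, ha, _⟩ => absurd ha (Finset.notMem_empty a)
  | .pad _ => exact (hstep _).2 fun ⟨a, ha, _⟩ => absurd ha (Finset.notMem_empty a)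
  | .hub => exact keep_hub h (by omega) hstep
  | .lane l =>
    have := l.2
    by_cases hl0 : l.val = 0
    · exact keep_lane_zero h hl hl0 hstep
    · exact keep_lane h hl0 (.inl ⟨by omega, hl⟩) hstep
  | .high k => exact keep_high h (.inr hl) (.inl (.inl (hbit k))) hstep
  | .bit k => exact keep_bit h (.inl (hbit k)) (.inr hl) hstep

theorem low_of_max : low n (2 ^ n - 1) = n := by
  refine le_antisymm (low_le _ _) ?_
  by_contra h
  have h1 := Nat.two_pow_pos n
  have h2 := succ_lt (n := n) (B := 2 ^ n - 1) (by omega) (by omega)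
  omega

section Run

variable {π : ℕ → Node n r → Act}

/-- The bound `B ≤ k` carries the lower bound: one iteration raises the counter by at most one. -/
theorem run_eq_pol (h0 : π 0 = pol 0 0)
    (hstep : ∀ k, (graph n r).toMDP.GreedyStep (π k) (π (k + 1))) (k : ℕ) :
    ∃ B ≤ k, ∃ t, Valid n B t ∧ π k = pol B t := by
  induction k with
  | zero => exact ⟨0, le_rfl, 0, ⟨Nat.two_pow_pos n, Nat.zero_le _, fun _ => Nat.zero_le _⟩, h0⟩
  | succ k ih =>
    obtain ⟨B, hB, t, hv, he⟩ := ih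
    have hs := hstep k
    rw [he] at hs
    by_cases hl : Late n B t
    · exact ⟨B + 1, by omega, 0, hv.succ_count hl, step_increment hv hl hs⟩
    · by_cases ht : low n B = n ∧ t = 2 * n
      · exact ⟨B, by omega, t, hv, step_final hv ht.1 ht.2 hs⟩
      · have ht' : low n B = n → t < 2 * n := fun hn =>
          lt_of_le_of_ne (hv.le_of_top hn) fun hc => ht ⟨hn, hc⟩
        exact ⟨B, by omega, t + 1, hv.succ_phase hl ht', step_within hv hl ht' hs⟩

theorem run_reaches_phase (hstep : ∀ k, (graph n r).toMDP.GreedyStep (π k) (π (k + 1)))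
    (h0 : ∃ k, π k = pol B 0) (h : Valid n B t) : ∃ k, π k = pol B t := by
  induction t with
  | zero => exact h0
  | succ t ih =>
    have hle := h.le
    have hv : Valid n B t := ⟨h.lt, by omega, fun hn => by have := h.le_of_top hn; omega⟩
    obtain ⟨k, hk⟩ := ih hv
    have hs := hstep k
    rw [hk] at hs
    exact ⟨k + 1, step_within hv (by simp only [Late]; omega) (fun hn => h.le_of_top hn) hs⟩

theorem run_reaches_count (h0 : π 0 = pol 0 0)
    (hstep : ∀ k, (graph n r).toMDP.GreedyStep (π k) (π (k + 1))) (hB : B < 2 ^ n) :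
    ∃ k, π k = pol B 0 := by
  induction B with
  | zero => exact ⟨0, h0⟩
  | succ B ih =>
    have hlow := low_lt hB
    have hv : Valid n B (2 * low n B + 3) := ⟨by omega, le_rfl, fun hn => by omega⟩
    obtain ⟨k, hk⟩ := run_reaches_phase hstep (ih (by omega)) hv
    have hs := hstep k
    rw [hk] at hs
    exact ⟨k + 1, step_increment hv rfl hs⟩

theorem run_reaches_optimal (h0 : π 0 = pol 0 0)
    (hstep : ∀ k, (graph n r).toMDP.GreedyStep (π k) (π (k + 1))) :
    ∃ k, (graph n r).toMDP.IsOptimal (π k) := by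
  have hpos := Nat.two_pow_pos n
  have hv : Valid n (2 ^ n - 1) (2 * n) :=
    ⟨by omega, by rw [low_of_max]; omega, fun _ => le_rfl⟩
  obtain ⟨k, hk⟩ := run_reaches_phase hstep (run_reaches_count h0 hstep (by omega)) hv
  have hs := hstep k
  rw [hk] at hs
  have he := step_final hv low_of_max rfl hs
  rw [he] at hs
  exact ⟨k, hk ▸ (graph n r).toMDP.isOptimal_of_greedyStep_self (isDist_pol hv).isPolicy hs⟩

theorem not_isOptimal_pol (h : Valid n B t) (hB : B + 1 < 2 ^ n) :
    ¬ (graph n r).toMDP.IsOptimal (pol B t) := by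
  rintro ⟨-, hopt⟩
  have hv : Valid n (2 ^ n - 1) 0 := ⟨by omega, Nat.zero_le _, fun _ => Nat.zero_le _⟩
  have hs : (act (.lane 0 : Node n r)).Nonempty :=
    ⟨.jump 0, (mem_act_lane_zero rfl).2 ⟨0, Nat.zero_le _, rfl⟩⟩
  -- Lane `0` has leading length `2 ^ n - 1 - B` in every phase, so the full counter is strictly
  -- better there.
  have h1 := hopt _ (isDist_pol hv).isPolicy (.lane 0)
  rw [(isDist_pol hv).val_eq (graph_proper n r) _ (.inr hs),
    (isDist_pol h).val_eq (graph_proper n r) _ (.inr hs)] at h1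
  refine absurd (LossyGraph.half_pow_lt ?_) h1.not_gt
  refine scale_lt_of_lex (.inl ?_) (distMinor_lt _)
  simp only [distMajor, Fin.val_zero, Nat.zero_le, if_true]
  omega

theorem le_of_isOptimal (h0 : π 0 = pol 0 0)
    (hstep : ∀ k, (graph n r).toMDP.GreedyStep (π k) (π (k + 1))) {k : ℕ}
    (hk : (graph n r).toMDP.IsOptimal (π k)) : 2 ^ n ≤ k + 1 := by
  by_contra hlt
  obtain ⟨B, hB, t, hv, he⟩ := run_eq_pol h0 hstep k
  exact not_isOptimal_pol hv (by omega) (he ▸ hk)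

end Run

end BinaryCounter

/-! ### The exponential bound in the number of nodes -/

open BinaryCounter in
theorem mainTheorem3 :
    ∃ c : ℝ, 0 < c ∧ ∃ N₀ : ℕ, ∀ N : ℕ, N₀ ≤ N →
      ∃ (S A : Type) (_ : Fintype S) (_ : DecidableEq S) (M : ReachabilityMDP S A) (π₀ : S → A),
        Fintype.card S = N ∧
        (∀ s, (M.act s).card ≤ N) ∧
        M.IsPolicy π₀ ∧
        ∀ π : ℕ → S → A, π 0 = π₀ → (∀ k, M.GreedyStep (π k) (π (k + 1))) →
          ∃ T : ℕ, (2 : ℝ) ^ (c * (N : ℝ)) ≤ (T : ℝ) ∧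
            M.IsOptimal (π T) ∧ ∀ k < T, ¬ M.IsOptimal (π k) := by
  refine ⟨1 / 16, by norm_num, 16, fun N hN => ?_⟩
  obtain ⟨n, r, hn, hr, hN'⟩ : ∃ n r, 1 ≤ n ∧ r < 4 ∧ N = 4 * n + r + 4 :=
    ⟨(N - 4) / 4, (N - 4) % 4, by omega, by omega, by omega⟩
  have hv : Valid n 0 0 := ⟨Nat.two_pow_pos n, Nat.zero_le _, fun _ => Nat.zero_le _⟩
  refine ⟨Node n r, Act, inferInstance, inferInstance, (graph n r).toMDP, pol 0 0,
    by rw [Node.card, hN'], fun s => hN' ▸ card_act_le s, (isDist_pol hv).isPolicy,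
    fun π h0 hstep => ?_⟩
  classical
  have hex := run_reaches_optimal h0 hstep
  refine ⟨Nat.find hex, ?_, Nat.find_spec hex, fun k hk => Nat.find_min hex hk⟩
  have hT := le_of_isOptimal h0 hstep (Nat.find_spec hex)
  -- The run takes at least `2 ^ n - 1` iterations, hence at least `2 ^ (n - 1)`. For `N ≥ 16` one
  -- has `n ≥ 3`, so `N ≤ 16 * (n - 1)`, which leaves ample room for the constant `1 / 16`.
  obtain ⟨m, rfl⟩ : ∃ m, n = m + 1 := ⟨n - 1, by omega⟩
  have h1 : 2 ^ m ≤ Nat.find hex := by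
    have := Nat.two_pow_pos m
    rw [pow_succ] at hT
    omega
  have h2 : (1 / 16 : ℝ) * N ≤ m := by
    have h3 : (N : ℝ) ≤ 16 * m := by exact_mod_cast (show N ≤ 16 * m by omega)
    linarith
  calc (2 : ℝ) ^ ((1 / 16 : ℝ) * N) ≤ (2 : ℝ) ^ (m : ℝ) :=
        Real.rpow_le_rpow_of_exponent_le (by norm_num) h2
    _ = ((2 ^ m : ℕ) : ℝ) := by rw [Real.rpow_natCast]; norm_cast
    _ ≤ _ := by exact_mod_cast h1
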